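/- An edge-to-edge tiling of the sphere is taken up to combinatorial equivalence: it is a finite set of tiles glued edge-to-edge along their sides so that the resulting closed surface is a sphere (it is connected, oriented, and satisfies $V-E+F=2$), and two tilings are the same if there is a bijection between their corners that preserves labels, tiles and vertices and either preserves all cyclic orders around tiles and vertices or reverses all of them (mirror image). We consider tilings by pentagons, in which every tile has five corners at five distinct vertices, every corner carries a label (for instance its angle value), and all tiles are congruent in the sense that the labels of the corners are arranged in the same way in every tile, up to rotation and reflection. For distinct labels $\alpha,\beta$, a tiling for $\mathrm{AVC}(2\mathrm{D}24)=\{24\alpha^4\beta: 32\alpha^3, 6\beta^4\}$ is one with exactly $24$ tiles, each with four corners $\alpha$ and one corner $\beta$, and exactly $38$ vertices, $32$ of which consist of three corners $\alpha$ and $6$ of which consist of four corners $\beta$; a tiling for $\mathrm{AVC}(2\mathrm{D}60)=\{60\alpha^4\beta: 80\alpha^3, 12\beta^5\}$ is one with exactly $60$ tiles, each with four corners $\alpha$ and one corner $\beta$, and exactly $92$ vertices, $80$ of which consist of three corners $\alpha$ and $12$ of which consist of five corners $\beta$. The pentagonal subdivision of a tiling of the sphere is obtained by dividing every edge into three parts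 by two new vertices, placing a new vertex inside every tile, and joining it, for every edge of the tile traversed counterclockwise around the tile, to the second of the two new vertices on that edge. Each resulting pentagon has exactly one corner at a new vertex inside a tile. Let $PP_6$ and $PP_{12}$ be the pentagonal subdivisions of the cube and of the dodecahedron; their $2\mathrm{D}$ reductions are the labelings in which, in every pentagon, the corner at the new vertex inside a face of the cube or dodecahedron is labeled $\beta$ and the other four corners are labeled $\alpha$. **Theorem.** A labeled tiling is a tiling for $\mathrm{AVC}(2\mathrm{D}24)$ if and only if it is (up to combinatorial equivalence, mirror images included) the $2\mathrm{D}$ reduction of $PP_6$, and it is a tiling for $\mathrm{AVC}(2\mathrm{D}60)$ if and only if it is the $2\mathrm{D}$ reduction of $PP_{12}$. -/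

import Mathlib

namespace SphereTiling

/-- A finite map on a closed oriented surface, given by its oriented edges ("darts").
`next d` is the oriented edge that follows `d` on the boundary of the tile to the left of `d`
(tiles are traversed counterclockwise), `opp d` is the same edge with the opposite orientation.

A dart `d` is identified with the corner, at the initial point of `d`, of the tile to the left
of `d`. Hence `D` is also the set of corners of the tiles, the tiles are the orbits of `next`,
and the edges are the orbits of `opp`. The surface is obtained by gluing the tiles edge-to-edge
according to `opp`. -/
structure OMap (D : Type*) where
  next : Equiv.Perm D
  opp : Equiv.Perm D
  opp_opp : ∀ d, opp (opp d) = d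
  opp_ne : ∀ d, opp d ≠ d

/-- The orbits of a permutation. -/
abbrev Orbit {D : Type*} (p : Equiv.Perm D) : Type _ :=
  Quotient (Equiv.Perm.SameCycle.setoid p)

namespace OMap

variable {D : Type*}

/-- The rotation about a vertex: `opp d` ends where `d` starts, so `next (opp d)` again starts
there. The vertices are the orbits of `vert`, an orbit being the set of corners at the vertex. -/
def vert (M : OMap D) : Equiv.Perm D := M.next * M.opp

/-- The surface is connected. -/
def Connected (M : OMap D) : Prop :=
  ∀ a b : D, ∃ g ∈ Subgroup.closure ({M.next, M.opp} : Set (Equiv.Perm D)), g a = b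

/-- The surface is a sphere: it is connected, with `V - E + F = 2`. -/
def IsSphere (M : OMap D) : Prop :=
  M.Connected ∧
    Nat.card (Orbit M.vert) + Nat.card (Orbit M.next) = Nat.card (Orbit M.opp) + 2

/-- Every tile is a pentagon whose boundary is a simple closed curve: it has five corners, and
they lie at five distinct vertices. -/
def Pentagonal (M : OMap D) : Prop :=
  (∀ d, Nat.card {e // M.next.SameCycle d e} = 5) ∧
    ∀ d e, M.next.SameCycle d e → M.vert.SameCycle d e → d = e

/-- All tiles are congruent with respect to the labels of their corners: for any two tiles, the
cyclic sequences of labels agree after some rotation, and possibly a reflection. -/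
def CornerCongruent {L : Type*} (M : OMap D) (lab : D → L) : Prop :=
  ∀ d e, ∃ e', M.next.SameCycle e e' ∧
    ((∀ k : ℕ, lab ((M.next ^ k) d) = lab ((M.next ^ k) e')) ∨
      (∀ k : ℕ, lab ((M.next ^ k) d) = lab ((M.next⁻¹ ^ k) e')))

end OMap

open Classical in
/-- The labels, with multiplicity, of the corners in an orbit (a tile or a vertex). -/
noncomputable def orbitLabels {D L : Type*} [Fintype D] (p : Equiv.Perm D) (lab : D → L)
    (q : Orbit p) : Multiset L :=
  (Finset.univ.filter (fun d : D => (Quotient.mk _ d : Orbit p) = q)).val.map lab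

open Classical in
/-- The label combinations, with multiplicity, of all the orbits of `p`. -/
noncomputable def combinations {D L : Type*} [Fintype D] (p : Equiv.Perm D) (lab : D → L) :
    Multiset (Multiset L) :=
  (Finset.univ : Finset (Orbit p)).val.map (orbitLabels p lab)

/-- An anglewise vertex combination with multiplicities: the angle combinations of all the tiles
and the angle combinations at all the vertices. -/
structure AVC (L : Type*) where
  tiles : Multiset (Multiset L)
  vertices : Multiset (Multiset L)

/-- `{24 α⁴β : 32 α³, 6 β⁴}` -/
def avc2D24 {L : Type*} (α β : L) : AVC L where
  tiles := Multiset.replicate 24 {α, α, α, α, β}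
  vertices := Multiset.replicate 32 {α, α, α} + Multiset.replicate 6 {β, β, β, β}

/-- `{60 α⁴β : 80 α³, 12 β⁵}` -/
def avc2D60 {L : Type*} (α β : L) : AVC L where
  tiles := Multiset.replicate 60 {α, α, α, α, β}
  vertices := Multiset.replicate 80 {α, α, α} + Multiset.replicate 12 {β, β, β, β, β}

/-- The labelled map is an edge-to-edge tiling of the sphere by congruent pentagons (with respect
to the labels of the corners) whose anglewise vertex combination is `A`. -/
structure IsTilingFor {D L : Type*} [Fintype D] (M : OMap D) (lab : D → L) (A : AVC L) :
    Prop where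
  sphere : M.IsSphere
  pentagonal : M.Pentagonal
  congruent : M.CornerCongruent lab
  tiles : combinations M.next lab = A.tiles
  vertices : combinations M.vert lab = A.vertices

/-- The two labelled maps are the same tiling: there is a bijection between the corners that
preserves the labels and carries the cyclic order of the corners in each tile and around each
vertex either to the cyclic order in the other map, or (a mirror image) to its reverse. -/
def SameTiling {D D' L : Type*} (M : OMap D) (lab : D → L) (M' : OMap D') (lab' : D' → L) :
    Prop :=
  ∃ e : D ≃ D', (∀ d, lab' (e d) = lab d) ∧
    (((∀ d, e (M.next d) = M'.next (e d)) ∧ (∀ d, e (M.vert d) = M'.vert (e d))) ∨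
      ((∀ d, e (M.next d) = M'.next.symm (e d)) ∧ (∀ d, e (M.vert d) = M'.vert.symm (e d))))

/-! ### Pentagonal subdivision -/

/-- The five corners `α, β, γ, δ, ε` of a pentagon. -/
inductive Corner
  | α | β | γ | δ | ε
  deriving DecidableEq

instance : Fintype Corner := ⟨{.α, .β, .γ, .δ, .ε}, fun x => by cases x <;> decide⟩

/-- Counterclockwise, the corners of the pentagon are `ε, α, δ, β, γ`. -/
def Corner.rot : Equiv.Perm Corner where
  toFun
    | .ε => .α
    | .α => .δ
    | .δ => .β
    | .β => .γ
    | .γ => .ε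
  invFun
    | .α => .ε
    | .δ => .α
    | .β => .δ
    | .γ => .β
    | .ε => .γ
  left_inv x := by cases x <;> rfl
  right_inv x := by cases x <;> rfl

/-- How the edges of the pentagons of the pentagonal subdivision are glued. -/
def pentSubOpp {D : Type*} (M : OMap D) : D × Corner → D × Corner
  | (d, .ε) => (M.next.symm d, .γ)
  | (d, .γ) => (M.next d, .ε)
  | (d, .α) => (M.opp (M.next.symm d), .δ)
  | (d, .δ) => (M.next (M.opp d), .α)
  | (d, .β) => (M.opp d, .β)

theorem pentSubOpp_invol {D : Type*} (M : OMap D) : Function.Involutive (pentSubOpp M) := by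
  rintro ⟨d, c⟩
  cases c <;> simp [pentSubOpp, M.opp_opp]

/-- The pentagonal subdivision of a map. Each edge is divided into three by two new points;
let `p d` be the one of them that is nearer to the initial point of the oriented edge `d`. Each
tile gets a new point in its interior, joined to the points `p (opp d)` for all the oriented
edges `d` on its boundary. So a tile with `k` edges is divided into `k` pentagons, one for each
of its corners. The pentagon of the corner `d` has, counterclockwise, the vertices
* `ε`: the new point inside the tile,
* `α`: the point `p (opp d')`, where `d'` is the oriented edge before `d`,
* `δ`: the initial point of `d`,
* `β`: the point `p d`,
* `γ`: the point `p (opp d)`. -/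
def pentSub {D : Type*} (M : OMap D) : OMap (D × Corner) where
  next := Equiv.prodCongr (Equiv.refl D) Corner.rot
  opp := (pentSubOpp_invol M).toPerm
  opp_opp := pentSubOpp_invol M
  opp_ne := by
    rintro ⟨d, c⟩
    cases c <;> simp [pentSubOpp, M.opp_ne]

/-- The reduction `α = β = γ = δ` of the labels `α, β, γ, δ, ε` to `α, α, α, α, β`. -/
def reduce2D {L : Type*} (α β : L) : Corner → L
  | .ε => β
  | _ => α

/-! ### The cube and the dodecahedron -/

/-- The faces of the cube: top, bottom, and four side faces. -/
inductive CubeFace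
  | top | side (i : Fin 4) | bottom
  deriving DecidableEq, Fintype

/-- The vertices of the top are `t j` and those of the bottom are `b j`, with `b j` below `t j`.
The vertices of the faces are, counterclockwise seen from outside and starting with the one of
index `0`:
* `top`: `t 0, t 1, t 2, t 3`;
* `side i`: `t (i+1), t i, b i, b (i+1)`;
* `bottom`: `b 0, b 3, b 2, b 1`.

The oriented edge `(F, j)` starts at the vertex of `F` of index `j`. -/
def cubeOpp : CubeFace × Fin 4 → CubeFace × Fin 4
  | (.top, j) => (.side j, 0)
  | (.side i, 0) => (.top, i)
  | (.side i, 1) => (.side (i - 1), 3)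
  | (.side i, 2) => (.bottom, -i - 1)
  | (.side i, 3) => (.side (i + 1), 1)
  | (.bottom, j) => (.side (-j - 1), 2)

theorem cubeOpp_invol : Function.Involutive cubeOpp := by
  unfold Function.Involutive; decide

/-- The cube. -/
def cube : OMap (CubeFace × Fin 4) where
  next := Equiv.prodCongr (Equiv.refl CubeFace) (Equiv.addRight 1)
  opp := cubeOpp_invol.toPerm
  opp_opp := cubeOpp_invol
  opp_ne := by
    change ∀ d, cubeOpp d ≠ d
    decide

/-- The faces of the dodecahedron: top, bottom, and two rings of five faces. -/
inductive DodecFace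
  | top | upper (i : Fin 5) | lower (i : Fin 5) | bottom
  deriving DecidableEq, Fintype

/-- The vertices are, from top to bottom, `t j`, `u j`, `v j`, `w j`. The vertices of the faces
are, counterclockwise seen from outside and starting with the one of index `0`:
* `top`: `t 0, t 1, t 2, t 3, t 4`;
* `upper i`: `t (i+1), t i, u i, v i, u (i+1)`;
* `lower i`: `u i, v (i-1), w (i-1), w i, v i`;
* `bottom`: `w 0, w 4, w 3, w 2, w 1`.

The oriented edge `(F, j)` starts at the vertex of `F` of index `j`. -/
def dodecOpp : DodecFace × Fin 5 → DodecFace × Fin 5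
  | (.top, j) => (.upper j, 0)
  | (.upper i, 0) => (.top, i)
  | (.upper i, 1) => (.upper (i - 1), 4)
  | (.upper i, 2) => (.lower i, 4)
  | (.upper i, 3) => (.lower (i + 1), 0)
  | (.upper i, 4) => (.upper (i + 1), 1)
  | (.lower i, 0) => (.upper (i - 1), 3)
  | (.lower i, 1) => (.lower (i - 1), 3)
  | (.lower i, 2) => (.bottom, -i)
  | (.lower i, 3) => (.lower (i + 1), 1)
  | (.lower i, 4) => (.upper i, 2)
  | (.bottom, j) => (.lower (-j), 2)

theorem dodecOpp_invol : Function.Involutive dodecOpp := by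
  unfold Function.Involutive; decide

/-- The dodecahedron. -/
def dodecahedron : OMap (DodecFace × Fin 5) where
  next := Equiv.prodCongr (Equiv.refl DodecFace) (Equiv.addRight 1)
  opp := dodecOpp_invol.toPerm
  opp_opp := dodecOpp_invol
  opp_ne := by
    change ∀ d, dodecOpp d ≠ d
    decide

/-- The pentagonal subdivision `PP₆` of the cube. -/
def PP6 : OMap ((CubeFace × Fin 4) × Corner) := pentSub cube

/-- The pentagonal subdivision `PP₁₂` of the dodecahedron. -/
def PP12 : OMap ((DodecFace × Fin 5) × Corner) := pentSub dodecahedron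

end SphereTiling

namespace SphereTiling

/-! ### Orbits of permutations and their label multisets -/

section Orbits

variable {D D' L : Type*}

/-! Number the edges of a tile 0, …, 4 counterclockwise from its corner `β`. Every vertex carries a
single label, so edges 0 are glued to edges 4. Degree three at the `α`-vertices leaves two choices
for edge 1: it meets an edge 2 (the tile is twisted) or an edge 1 (`LocalTiling.twisted_or`). The
same degree condition propagates twistedness around `β`-vertices and across all edges. By
connectedness, all tiles are twisted either in the tiling or in its mirror image
(`LocalTiling.forall_twisted_or_mirror`).

When all tiles are twisted, the gluing is forced: 0 with 4, 1 with 2, 3 with 3. This is the gluing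
rule of a pentagonal subdivision. The corners `β` are the oriented edges of a map `N` whose tiles
are the `β`-vertices and whose `opp` crosses edge 3, and the tiling is `pentSub N`
(`exists_pentSub_equiv_of_twisted`). Here `N` is connected with 24 or 60 oriented edges, `next ^ k =
1` for `k` = 4 or 5, and `vert ^ 3 = 1`.

Such an `N` is Platonic. Label the oriented edges of the cube or dodecahedron by words in `n` and
`o`. The relations `n ^ k = o ^ 2 = (n * o) ^ 3 = 1` alone imply that left multiplication by `n` and
`o` acts on the words as `next` and `opp`. Applying the words to a base edge of `N` gives a
morphism, onto by connectedness and bijective by counting (`exists_equiv_cube`,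
`exists_equiv_dodecahedron`).

Conversely, orbit counts in the subdivision give the required combinations and Euler's relation
(`isTilingFor_pentSub`), and being a tiling is invariant under `SameTiling`. -/

theorem sameCycle_iff_exists_lt [Finite D] (p : Equiv.Perm D) (d e : D) :
    p.SameCycle d e ↔ ∃ i < Function.minimalPeriod p d, (p ^ i) d = e := by
  constructor
  · intro h
    obtain ⟨i, hi⟩ := h.exists_nat_pow_eq
    have hpos : 0 < Function.minimalPeriod p d :=
      Function.minimalPeriod_pos_of_mem_periodicPts
        (Function.Injective.mem_periodicPts p.injective d)
    refine ⟨i % Function.minimalPeriod p d, Nat.mod_lt _ hpos, ?_⟩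
    rw [← hi, ← Equiv.Perm.iterate_eq_pow, ← Equiv.Perm.iterate_eq_pow,
      Function.iterate_mod_minimalPeriod_eq]
  · rintro ⟨i, -, hi⟩
    exact ⟨i, by simpa using hi⟩

open Classical in
theorem orbitLabels_mk [Fintype D] (p : Equiv.Perm D) (lab : D → L) (d : D) :
    orbitLabels p lab (Quotient.mk _ d) =
      (Multiset.range (Function.minimalPeriod p d)).map fun i => lab ((p ^ i) d) := by
  have hinj : Set.InjOn (fun i => (p ^ i) d)
      (Finset.range (Function.minimalPeriod p d) : Set ℕ) := by
    intro i hi j hj hij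
    simp only [Finset.coe_range, Set.mem_Iio] at hi hj
    simp only [← Equiv.Perm.iterate_eq_pow] at hij
    exact (Function.iterate_eq_iterate_iff_of_lt_minimalPeriod hi hj).1 hij
  have h : (Finset.univ.filter fun e : D => (Quotient.mk _ e : Orbit p) = Quotient.mk _ d) =
      (Finset.range (Function.minimalPeriod p d)).image fun i => (p ^ i) d := by
    ext e
    simp only [Finset.mem_filter, Finset.mem_univ, true_and, Finset.mem_image, Finset.mem_range]
    rw [Quotient.eq, ← sameCycle_iff_exists_lt]
    exact ⟨fun h => h.symm, fun h => h.symm⟩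
  rw [orbitLabels]
  rw [show (Finset.univ.filter fun e : D => (Quotient.mk _ e : Orbit p) = Quotient.mk _ d).val =
      ((Finset.range (Function.minimalPeriod p d)).image fun i => (p ^ i) d).val from
    congrArg _ h, Finset.image_val_of_injOn hinj, Multiset.map_map]
  rfl

theorem card_orbitLabels_mk [Fintype D] (p : Equiv.Perm D) (lab : D → L) (d : D) :
    (orbitLabels p lab (Quotient.mk _ d)).card = Function.minimalPeriod p d := by
  simp [orbitLabels_mk]

theorem natCard_sameCycle [Finite D] (p : Equiv.Perm D) (d : D) :
    Nat.card {e // p.SameCycle d e} = Function.minimalPeriod p d := by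
  classical
  have := Fintype.ofFinite D
  rw [← card_orbitLabels_mk p (fun e => e) d, orbitLabels, Multiset.card_map, Nat.card_eq_fintype_card,
    Fintype.card_subtype]
  change Finset.card _ = Finset.card _
  congr 1
  ext e
  simp only [Finset.mem_filter, Finset.mem_univ, true_and]
  rw [Quotient.eq]
  exact ⟨fun h => h.symm, fun h => h.symm⟩

/-- The total is independent of `p`. Applied to `next` and `vert`, it transfers corner counts from
tiles to vertices. -/
theorem sum_combinations [Fintype D] (p : Equiv.Perm D) (lab : D → L) :
    (combinations p lab).sum = Finset.univ.val.map lab := by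
  classical
  have h : ∀ s : Finset D, s.val.map lab = ∑ d ∈ s, ({lab d} : Multiset L) := fun s => by
    rw [← Multiset.sum_map_singleton (s.val.map lab), Multiset.map_map]; rfl
  rw [combinations]
  change ∑ q : Orbit p, orbitLabels p lab q = _
  rw [h, ← Finset.sum_fiberwise (s := Finset.univ) (g := fun d => (Quotient.mk _ d : Orbit p))]
  refine Finset.sum_congr (by congr) fun q _ => ?_
  rw [orbitLabels, h]

theorem natCard_orbit [Fintype D] (p : Equiv.Perm D) (lab : D → L) :
    Nat.card (Orbit p) = (combinations p lab).card := by
  classical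
  rw [combinations, Multiset.card_map, Nat.card_eq_fintype_card]
  rfl

theorem orbitLabels_mem_combinations [Fintype D] (p : Equiv.Perm D) (lab : D → L) (d : D) :
    orbitLabels p lab (Quotient.mk _ d) ∈ combinations p lab := by
  classical
  exact Multiset.mem_map_of_mem _ (Finset.mem_univ _)

theorem exists_of_mem_combinations [Fintype D] {p : Equiv.Perm D} {lab : D → L} {m : Multiset L}
    (h : m ∈ combinations p lab) : ∃ d, orbitLabels p lab (Quotient.mk _ d) = m := by
  classical
  obtain ⟨q, -, rfl⟩ := Multiset.mem_map.1 h
  induction q using Quotient.inductionOn with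
  | h d => exact ⟨d, rfl⟩

/-- The orbits of all points having period `k`, there are `|D| / k` of them. -/
theorem natCard_orbit_mul [Fintype D] (p : Equiv.Perm D) {k : ℕ}
    (h : ∀ d, Function.minimalPeriod p d = k) : Nat.card (Orbit p) * k = Fintype.card D := by
  have h1 : (combinations p (fun d => d)).map Multiset.card =
      Multiset.replicate (Nat.card (Orbit p)) k := by
    rw [Multiset.eq_replicate]
    refine ⟨by rw [Multiset.card_map, natCard_orbit], fun b hb => ?_⟩
    obtain ⟨m, hm, rfl⟩ := Multiset.mem_map.1 hb
    obtain ⟨d, rfl⟩ := exists_of_mem_combinations hm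
    rw [card_orbitLabels_mk, h]
  have h2 := congrArg Multiset.card (sum_combinations p (fun d => d))
  rw [← Multiset.join, Multiset.card_join, h1] at h2
  simpa using h2

/-- An equivalence under which orbits correspond to orbits. -/
def orbitEquiv {p : Equiv.Perm D} {p' : Equiv.Perm D'} (e : D ≃ D')
    (h : ∀ a b, p.SameCycle a b ↔ p'.SameCycle (e a) (e b)) : Orbit p ≃ Orbit p' :=
  Quotient.congr e h

theorem combinations_congr [Fintype D] [Fintype D'] {p : Equiv.Perm D} {p' : Equiv.Perm D'}
    {lab : D → L} {lab' : D' → L} (e : D ≃ D')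
    (h : ∀ a b, p.SameCycle a b ↔ p'.SameCycle (e a) (e b)) (hl : ∀ d, lab' (e d) = lab d) :
    combinations p lab = combinations p' lab' := by
  classical
  have h1 : ∀ q : Orbit p, orbitLabels p lab q = orbitLabels p' lab' (orbitEquiv e h q) := by
    intro q
    rw [orbitLabels, orbitLabels]
    have : (Finset.univ.filter fun d' : D' => (Quotient.mk _ d' : Orbit p') = orbitEquiv e h q) =
        (Finset.univ.filter fun d : D => (Quotient.mk _ d : Orbit p) = q).map e.toEmbedding := by
      ext d'
      simp only [Finset.mem_filter, Finset.mem_univ, true_and, Finset.mem_map_equiv]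
      rw [← (orbitEquiv e h).apply_eq_iff_eq]
      simp [orbitEquiv]
    have h3 := congrArg (fun s : Finset D' => s.val.map lab') this
    simp only [Finset.map_val, Multiset.map_map] at h3
    convert h3.symm using 2
    exact (hl _).symm
  rw [combinations, combinations, ← Finset.map_univ_equiv (orbitEquiv e h), Finset.map_val,
    Multiset.map_map]
  exact Multiset.map_congr rfl fun q _ => h1 q

theorem minimalPeriod_eq_of_semiconj {p : Equiv.Perm D} {p' : Equiv.Perm D'} {f : D → D'}
    (hf : Function.Injective f) (h : Function.Semiconj f p p') (d : D) :
    Function.minimalPeriod p' (f d) = Function.minimalPeriod p d := by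
  rw [Function.minimalPeriod_eq_minimalPeriod_iff]
  intro n
  rw [Function.IsPeriodicPt, Function.IsPeriodicPt, Function.IsFixedPt, Function.IsFixedPt,
    ← (h.iterate_right n).eq, hf.eq_iff]

theorem sameCycle_congr {p : Equiv.Perm D} {p' : Equiv.Perm D'} (e : D ≃ D')
    (h : ∀ d, e (p d) = p' (e d)) (a b : D) : p.SameCycle a b ↔ p'.SameCycle (e a) (e b) := by
  have : p' = e.permCongr p := by
    ext d'
    obtain ⟨d, rfl⟩ := e.surjective d'
    simp [h]
  subst this
  have hz : ∀ i : ℤ, (e.permCongr p ^ i) (e a) = e ((p ^ i) a) := fun i => by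
    have := map_zpow e.permCongrHom p i
    have h2 : e.permCongrHom p = e.permCongr p := rfl
    rw [h2] at this
    rw [← this]
    simp [Equiv.permCongrHom]
  simp only [Equiv.Perm.SameCycle, hz, e.apply_eq_iff_eq]

end Orbits

/-! ### Connectedness and mirror images -/

namespace OMap

variable {D D' : Type*}

/-- By finiteness, a set mapped into itself by a permutation is also mapped into itself by the
inverse, so `S` is stable under the generated group. -/
theorem Connected.mem_of_closed [Finite D] {M : OMap D} (h : M.Connected) {S : Set D} {a : D}
    (ha : a ∈ S) (hn : ∀ d ∈ S, M.next d ∈ S) (ho : ∀ d ∈ S, M.opp d ∈ S) (d : D) : d ∈ S := by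
  obtain ⟨g, hg, rfl⟩ := h a d
  suffices Set.MapsTo g S S from this ha
  induction hg using Subgroup.closure_induction with
  | mem x hx =>
    rcases hx with rfl | rfl
    · exact hn
    · exact ho
  | one => exact fun _ h => h
  | mul x y _ _ hx hy => exact hx.comp hy
  | inv x _ hx => exact Equiv.Perm.perm_symm_mapsTo_of_mapsTo x hx

theorem connected_of_forall_closed {M : OMap D} (a : D)
    (h : ∀ S : Set D, a ∈ S → (∀ d ∈ S, M.next d ∈ S) → (∀ d ∈ S, M.opp d ∈ S) → ∀ d, d ∈ S) :
    M.Connected := by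
  have key := h {d | ∃ g ∈ Subgroup.closure ({M.next, M.opp} : Set (Equiv.Perm D)), g a = d}
    ⟨1, one_mem _, rfl⟩
    (by
      rintro _ ⟨g, hg, rfl⟩
      exact ⟨M.next * g, mul_mem (Subgroup.subset_closure (by simp)) hg, rfl⟩)
    (by
      rintro _ ⟨g, hg, rfl⟩
      exact ⟨M.opp * g, mul_mem (Subgroup.subset_closure (by simp)) hg, rfl⟩)
  intro b c
  obtain ⟨g, hg, rfl⟩ := key b
  obtain ⟨g', hg', rfl⟩ := key c
  exact ⟨g' * g⁻¹, mul_mem hg' (inv_mem hg), by simp⟩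

/-- The mirror image of a map. A corner of the map is regarded as a corner of the mirror image,
so that the cyclic orders of the corners in the tiles and around the vertices are reversed. -/
def mirror (M : OMap D) : OMap D where
  next := M.next⁻¹
  -- As an oriented edge of the mirror image, the corner `d` leaves along the edge that arrived at
  -- `d`, which is that of `next⁻¹ d`.
  opp := M.next * M.opp * M.next⁻¹
  opp_opp d := by simp [M.opp_opp]
  opp_ne d := by
    have := M.opp_ne (M.next⁻¹ d)
    contrapose! this
    simpa using congrArg (⇑M.next⁻¹) this

theorem vert_mirror (M : OMap D) : M.mirror.vert = M.vert⁻¹ := by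
  have h : M.opp⁻¹ = M.opp := by
    rw [inv_eq_iff_mul_eq_one]
    exact Equiv.ext M.opp_opp
  simp [mirror, vert, h, mul_assoc]

theorem Connected.mirror [Finite D] {M : OMap D} (h : M.Connected) : M.mirror.Connected := by
  intro a b
  refine connected_of_forall_closed a (fun S ha hn ho => ?_) a b
  have hn' : ∀ d ∈ S, M.next d ∈ S := by
    have := Equiv.Perm.perm_symm_mapsTo_of_mapsTo M.mirror.next (s := S) hn
    exact fun d hd => this hd
  refine h.mem_of_closed ha hn' fun d hd => ?_
  have := hn _ (ho _ (hn' _ hd))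
  simpa [OMap.mirror] using this

end OMap

end SphereTiling

/-! ### Uniqueness of the cube and the dodecahedron -/

namespace SphereTiling

/-- A map from a finite map to a connected one is bijective if both have the same number of
oriented edges. -/
theorem OMap.Connected.bijective_of_semiconj {D E : Type*} [Fintype D] [Fintype E] [Nonempty D]
    {M : OMap D} {N : OMap E} (hN : N.Connected) (hcard : Fintype.card D = Fintype.card E)
    {f : D → E} (hn : ∀ d, f (M.next d) = N.next (f d)) (ho : ∀ d, f (M.opp d) = N.opp (f d)) :
    Function.Bijective f := by
  rw [Fintype.bijective_iff_surjective_and_card]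
  refine ⟨fun e => ?_, hcard⟩
  refine hN.mem_of_closed (S := Set.range f) ⟨Classical.arbitrary D, rfl⟩ ?_ ?_ e
  · rintro _ ⟨d, rfl⟩
    exact ⟨_, hn d⟩
  · rintro _ ⟨d, rfl⟩
    exact ⟨_, ho d⟩

section FinPow

variable {G : Type*} [Group G] {n : G} {k : ℕ}

/-- Exponents may be read in `Fin k`, which matches the cyclic indices of faces and edges. -/
theorem pow_val_add (hn : n ^ k = 1) (i j : Fin k) :
    n ^ (i + j).val = n ^ i.val * n ^ j.val := by
  rw [Fin.val_add, ← pow_add, ← pow_eq_pow_mod _ hn]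

theorem pow_val_neg [NeZero k] (hn : n ^ k = 1) (i : Fin k) : n ^ (-i).val = (n ^ i.val)⁻¹ := by
  rw [eq_inv_iff_mul_eq_one, ← pow_val_add hn]
  simp

theorem pow_val_sub [NeZero k] (hn : n ^ k = 1) (i j : Fin k) :
    n ^ (i - j).val = n ^ i.val * (n ^ j.val)⁻¹ := by
  rw [sub_eq_add_neg, pow_val_add hn, pow_val_neg hn]

end FinPow

section

variable {E : Type*} {N : OMap E} {k : ℕ}

theorem OMap.opp_mul_opp (N : OMap E) : N.opp * N.opp = 1 := Equiv.ext N.opp_opp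

/-- This is `(next * opp) ^ 3 = 1` in the form of a rewriting rule. -/
theorem OMap.next_opp_next (hv : ∀ d, (N.vert ^ 3) d = d) :
    N.next * N.opp * N.next = N.opp * N.next⁻¹ * N.opp := by
  have h : N.vert ^ 3 = 1 := Equiv.ext hv
  have ho : N.opp⁻¹ = N.opp := inv_eq_iff_mul_eq_one.2 N.opp_mul_opp
  have h2 : N.next * N.opp * N.next * (N.opp * N.next * N.opp) = 1 := by
    simpa [OMap.vert, pow_succ, mul_assoc] using h
  rw [eq_inv_of_mul_eq_one_left h2]
  simp [ho, mul_assoc]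

end

section Cube

variable {G : Type*} [Group G]

/-- The element of a group generated by `n` and `o` that carries the oriented edge `(top, 0)` of
the cube to a given one. -/
def cubeWord (n o : G) : CubeFace × Fin 4 → G
  | (.top, j) => n ^ j.val
  | (.side i, j) => n ^ j.val * (o * n ^ i.val)
  | (.bottom, j) => n ^ j.val * (n * o * n ^ 2 * o)

theorem cubeWord_next {n : G} (o : G) (hn : n ^ 4 = 1) (d : CubeFace × Fin 4) :
    cubeWord n o (cube.next d) = n * cubeWord n o d := by
  obtain ⟨F, j⟩ := d
  have h : n ^ (j + 1).val = n * n ^ j.val := by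
    rw [add_comm, pow_val_add hn]; simp
  cases F <;> simp only [cube, Equiv.prodCongr_apply, Prod.map_apply, Equiv.coe_addRight,
    Equiv.refl_apply, cubeWord, h, mul_assoc]

theorem cubeWord_opp {n o : G} (hn : n ^ 4 = 1) (ho : o * o = 1)
    (hr : n * o * n = o * n⁻¹ * o) (d : CubeFace × Fin 4) :
    cubeWord n o (cubeOpp d) = o * cubeWord n o d := by
  have ho' : ∀ x, o * (o * x) = x := fun x => by rw [← mul_assoc, ho, one_mul]
  have hr' : ∀ x, n * (o * (n * x)) = o * (n⁻¹ * (o * x)) := fun x => by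
    simpa [mul_assoc] using congrArg (· * x) hr
  have h3 : n ^ 3 = n⁻¹ := by rw [eq_inv_iff_mul_eq_one, ← pow_succ, hn]
  have h2 : n ^ 2 = n⁻¹ * n⁻¹ := by
    rw [← mul_inv_rev, eq_inv_iff_mul_eq_one, ← hn]; group
  -- Crossing a side face from top to bottom reverses the rotation; this makes the four routes to
  -- the bottom agree.
  have hW : SemiconjBy (o * n ^ 2 * o) n n⁻¹ := by
    rw [SemiconjBy, eq_inv_mul_iff_mul_eq]
    calc n * (o * n ^ 2 * o * n) = (n * o * n) * (n * o * n) := by simp [pow_two, mul_assoc]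
      _ = o * (n⁻¹ * n⁻¹) * o := by rw [hr]; simp [mul_assoc, ho']
      _ = o * n ^ 2 * o := by rw [h2]
  have hW' : ∀ i : ℕ, o * (n ^ 2 * (o * n ^ i)) = (n ^ i)⁻¹ * (o * (n ^ 2 * o)) := fun i => by
    simpa [mul_assoc, SemiconjBy] using hW.pow_right i
  have hc : ∀ i : ℕ, n ^ i * n⁻¹ = n⁻¹ * n ^ i := fun i => by group
  have hside : ∀ i : Fin 4, o * (n * (o * n ^ i.val)) = n ^ 3 * (o * n ^ (i - 1).val) := by
    intro i
    rw [pow_val_sub hn, h3, eq_inv_mul_iff_mul_eq, hr', ho']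
    simp [hc]
  have hbot : ∀ i : Fin 4, n ^ (-i - 1).val * (n * o * n ^ 2 * o) = o * (n ^ 2 * (o * n ^ i.val)) := by
    intro i
    simp [hW', pow_val_sub hn, pow_val_neg hn, mul_assoc]
  obtain ⟨F, j⟩ := d
  rcases F with _ | i | _
  · simp [cubeOpp, cubeWord]
  · fin_cases j
    · simp [cubeOpp, cubeWord, ho']
    · simp [cubeOpp, cubeWord, hside]
    · simp [cubeOpp, cubeWord, hbot]
    -- The same edge between two side faces, seen from the other face.
    · have := hside (i + 1)
      simp only [add_sub_cancel_right] at this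
      simp [cubeOpp, cubeWord, ← this, ho']
  · have := hbot (-j - 1)
    simp only [neg_sub, sub_neg_eq_add, add_sub_cancel_left] at this
    simp [cubeOpp, cubeWord, this, ho']

/-- A connected map with 24 oriented edges in which, up to degeneration, the tiles have four
edges and the vertices have degree three is the cube. -/
theorem exists_equiv_cube {E : Type*} [Fintype E] {N : OMap E} (hcard : Fintype.card E = 24)
    (hN : N.Connected) (hn : ∀ d, (N.next ^ 4) d = d) (hv : ∀ d, (N.vert ^ 3) d = d) :
    ∃ e : CubeFace × Fin 4 ≃ E, (∀ d, e (cube.next d) = N.next (e d)) ∧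
      ∀ d, e (cube.opp d) = N.opp (e d) := by
  obtain ⟨a⟩ : Nonempty E := Fintype.card_pos_iff.1 (by omega)
  have h1 : ∀ d, cubeWord N.next N.opp (cube.next d) a = N.next (cubeWord N.next N.opp d a) :=
    fun d => by rw [cubeWord_next _ (Equiv.ext hn)]; rfl
  have h2 : ∀ d, cubeWord N.next N.opp (cube.opp d) a = N.opp (cubeWord N.next N.opp d a) :=
    fun d => by
      rw [← Equiv.Perm.mul_apply,
        ← cubeWord_opp (Equiv.ext hn) N.opp_mul_opp (N.next_opp_next hv)]
      rfl
  have : Nonempty (CubeFace × Fin 4) := ⟨(.top, 0)⟩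
  exact ⟨Equiv.ofBijective (fun d => cubeWord N.next N.opp d a)
    (hN.bijective_of_semiconj (M := cube) (hcard ▸ by decide) h1 h2), h1, h2⟩

end Cube

section Dodecahedron

variable {G : Type*} [Group G]

/-- The element of a group generated by `n` and `o` that carries the oriented edge `(top, 0)` of
the dodecahedron to a given one. -/
def dodecWord (n o : G) : DodecFace × Fin 5 → G
  | (.top, j) => n ^ j.val
  | (.upper i, j) => n ^ j.val * (o * n ^ i.val)
  | (.lower i, j) => n ^ j.val * (n * o * n ^ 2 * o * n ^ i.val)
  | (.bottom, j) => n ^ j.val * (o * n ^ 3 * o * n ^ 2 * o)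

theorem dodecWord_next {n : G} (o : G) (hn : n ^ 5 = 1) (d : DodecFace × Fin 5) :
    dodecWord n o (dodecahedron.next d) = n * dodecWord n o d := by
  obtain ⟨F, j⟩ := d
  have h : n ^ (j + 1).val = n * n ^ j.val := by
    rw [add_comm, pow_val_add hn]; simp
  cases F <;> simp only [dodecahedron, Equiv.prodCongr_apply, Prod.map_apply, Equiv.coe_addRight,
    Equiv.refl_apply, dodecWord, h, mul_assoc]

theorem dodecWord_opp {n o : G} (hn : n ^ 5 = 1) (ho : o * o = 1)
    (hr : n * o * n = o * n⁻¹ * o) (d : DodecFace × Fin 5) :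
    dodecWord n o (dodecOpp d) = o * dodecWord n o d := by
  have ho' : ∀ x, o * (o * x) = x := fun x => by rw [← mul_assoc, ho, one_mul]
  have hr' : ∀ x, n * (o * (n * x)) = o * (n⁻¹ * (o * x)) := fun x => by
    simpa [mul_assoc] using congrArg (· * x) hr
  have h4 : n ^ 4 = n⁻¹ := by rw [eq_inv_iff_mul_eq_one, ← pow_succ, hn]
  have h3 : n ^ 3 = n⁻¹ * n⁻¹ := by
    rw [← mul_inv_rev, eq_inv_iff_mul_eq_one, ← hn]; group
  have h2 : ∀ x, n ^ 2 * x = n * (n * x) := fun x => by rw [pow_two, mul_assoc]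
  have h5 : ∀ x, n * (n * (n * (n * (n * x)))) = x := fun x => by
    simpa only [pow_succ, pow_zero, one_mul, mul_assoc] using congrArg (· * x) hn
  have h2' : ∀ x, n⁻¹ * (n⁻¹ * (n⁻¹ * x)) = n * (n * x) := fun x => by
    rw [inv_mul_eq_iff_eq_mul, inv_mul_eq_iff_eq_mul, inv_mul_eq_iff_eq_mul, h5]
  have h3' : ∀ x, n⁻¹ * (n⁻¹ * x) = n * (n * (n * x)) := fun x => by
    rw [inv_mul_eq_iff_eq_mul, inv_mul_eq_iff_eq_mul, h5]
  have hc : ∀ i : ℕ, n ^ i * n⁻¹ = n⁻¹ * n ^ i := fun i => by group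
  -- `hupper`, `hmid`, `hlower` and `hbot` treat the edges between two upper faces, between `upper
  -- (i - 1)` and `lower i`, between two lower faces, and at the bottom. The other edges are settled
  -- by the choice of the words.
  have hupper : ∀ i : Fin 5, o * (n * (o * n ^ i.val)) = n ^ 4 * (o * n ^ (i - 1).val) := by
    intro i
    rw [pow_val_sub hn, h4, eq_inv_mul_iff_mul_eq, hr', ho']
    simp [hc]
  have hmid : ∀ i : Fin 5, n * (o * (n ^ 2 * (o * n ^ i.val))) =
      o * (n ^ 3 * (o * n ^ (i - 1).val)) := by
    intro i
    obtain ⟨j, rfl⟩ : ∃ j, i = 1 + j := ⟨i - 1, (add_sub_cancel _ _).symm⟩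
    rw [add_sub_cancel_left, pow_val_add hn, Fin.val_one, pow_one, h2, hr', hr', ho', h3, mul_assoc]
  have hk : ∀ x, n * (o * (n * (o * (n⁻¹ * (n⁻¹ * (o * x)))))) = o * (n * (n * (o * x))) := by
    intro x
    rw [hr', ho', h2']
  have hlower : ∀ i : Fin 5, o * (n * (n * o * n ^ 2 * o * n ^ i.val)) =
      n ^ 3 * (n * o * n ^ 2 * o * n ^ (i - 1).val) := by
    intro i
    obtain ⟨j, rfl⟩ : ∃ j, i = 1 + j := ⟨i - 1, (add_sub_cancel _ _).symm⟩
    have : ∀ x, n ^ 3 * (n * x) = n⁻¹ * x := fun x => by rw [← mul_assoc, ← pow_succ, h4]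
    rw [add_sub_cancel_left, pow_val_add hn, Fin.val_one, pow_one]
    simp only [mul_assoc, this, h2]
    rw [hr' (n ^ j.val), hr', ho', eq_inv_mul_iff_mul_eq, hk]
  -- As for the cube, the route from top to bottom reverses the rotation.
  have hW : SemiconjBy (o * n ^ 3 * o * n ^ 2 * o) n n⁻¹ := by
    rw [SemiconjBy, eq_inv_mul_iff_mul_eq]
    have : n * (o * (n⁻¹ * (n⁻¹ * (o * (n * (n * (o * (n * 1)))))))) =
        o * (n⁻¹ * (n⁻¹ * (o * (n * (n * (o * 1)))))) := by
      rw [h3' (o * (n * (n * (o * (n * 1))))), hr' 1, hr' (o * _), ho', hr', ← hk]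
      simp
    simpa only [pow_two, h3, pow_succ, pow_zero, mul_assoc, one_mul, mul_one] using this
  have hW' : ∀ i : ℕ, o * (n ^ 3 * (o * (n ^ 2 * (o * n ^ i)))) =
      (n ^ i)⁻¹ * (o * (n ^ 3 * (o * (n ^ 2 * o)))) := fun i => by
    simpa [mul_assoc, SemiconjBy] using hW.pow_right i
  have hbot : ∀ i : Fin 5, n ^ (-i).val * (o * n ^ 3 * o * n ^ 2 * o) =
      o * (n ^ 2 * (n * o * n ^ 2 * o * n ^ i.val)) := by
    intro i
    have : ∀ x, n ^ 2 * (n * x) = n ^ 3 * x := fun x => by rw [← mul_assoc, ← pow_succ]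
    simp [hW', pow_val_neg hn, mul_assoc, this]
  obtain ⟨F, j⟩ := d
  rcases F with _ | i | i | _
  · simp [dodecOpp, dodecWord]
  · fin_cases j
    · simp [dodecOpp, dodecWord, ho']
    · simp [dodecOpp, dodecWord, hupper]
    · simp [dodecOpp, dodecWord, h4, mul_assoc]
    · have := hmid (i + 1)
      simp only [add_sub_cancel_right] at this
      simp [dodecOpp, dodecWord, this, mul_assoc]
    · have := hupper (i + 1)
      simp only [add_sub_cancel_right] at this
      simp [dodecOpp, dodecWord, ← this, ho']
  · fin_cases j
    · simp [dodecOpp, dodecWord, hmid, ho', mul_assoc]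
    · simp [dodecOpp, dodecWord, hlower]
    · simp [dodecOpp, dodecWord, hbot]
    · have := hlower (i + 1)
      simp only [add_sub_cancel_right] at this
      simp [dodecOpp, dodecWord, ← this, ho']
    · simp [dodecOpp, dodecWord, h4, ho', mul_assoc]
  · have := hbot (-j)
    simp only [neg_neg] at this
    simp [dodecOpp, dodecWord, this, ho']

/-- A connected map with 60 oriented edges in which, up to degeneration, the tiles have five
edges and the vertices have degree three is the dodecahedron. -/
theorem exists_equiv_dodecahedron {E : Type*} [Fintype E] {N : OMap E}
    (hcard : Fintype.card E = 60) (hN : N.Connected) (hn : ∀ d, (N.next ^ 5) d = d)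
    (hv : ∀ d, (N.vert ^ 3) d = d) :
    ∃ e : DodecFace × Fin 5 ≃ E, (∀ d, e (dodecahedron.next d) = N.next (e d)) ∧
      ∀ d, e (dodecahedron.opp d) = N.opp (e d) := by
  obtain ⟨a⟩ : Nonempty E := Fintype.card_pos_iff.1 (by omega)
  have h1 : ∀ d, dodecWord N.next N.opp (dodecahedron.next d) a =
      N.next (dodecWord N.next N.opp d a) :=
    fun d => by rw [dodecWord_next _ (Equiv.ext hn)]; rfl
  have h2 : ∀ d, dodecWord N.next N.opp (dodecahedron.opp d) a =
      N.opp (dodecWord N.next N.opp d a) :=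
    fun d => by
      rw [← Equiv.Perm.mul_apply,
        ← dodecWord_opp (Equiv.ext hn) N.opp_mul_opp (N.next_opp_next hv)]
      rfl
  have : Nonempty (DodecFace × Fin 5) := ⟨(.top, 0)⟩
  exact ⟨Equiv.ofBijective (fun d => dodecWord N.next N.opp d a)
    (hN.bijective_of_semiconj (M := dodecahedron) (hcard ▸ by decide) h1 h2), h1, h2⟩

end Dodecahedron

end SphereTiling

/-! ### Pentagonal subdivisions are tilings -/

namespace SphereTiling

section

variable {D L : Type*}

theorem pow_eq_self_of_minimalPeriod_eq {p : Equiv.Perm D} {d : D} {k : ℕ}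
    (h : Function.minimalPeriod p d = k) : (p ^ k) d = d := by
  rw [← h, ← Equiv.Perm.iterate_eq_pow]
  exact Function.isPeriodicPt_minimalPeriod _ _

theorem minimalPeriod_inv (p : Equiv.Perm D) (d : D) :
    Function.minimalPeriod (p⁻¹ : Equiv.Perm D) d = Function.minimalPeriod p d := by
  rw [Function.minimalPeriod_eq_minimalPeriod_iff]
  intro n
  simp only [Function.IsPeriodicPt, Function.IsFixedPt, Equiv.Perm.iterate_eq_pow]
  rw [inv_pow, Equiv.Perm.inv_eq_iff_eq, eq_comm]

theorem apply_pow_of_invariant {p : Equiv.Perm D} {lab : D → L} (h : ∀ d, lab (p d) = lab d)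
    (i : ℕ) (d : D) : lab ((p ^ i) d) = lab d := by
  induction i with
  | zero => rfl
  | succ i ih => rw [pow_succ', Equiv.Perm.mul_apply, h, ih]

theorem orbitLabels_of_invariant [Fintype D] {p : Equiv.Perm D} {lab : D → L}
    (h : ∀ d, lab (p d) = lab d) (d : D) :
    orbitLabels p lab (Quotient.mk _ d) =
      Multiset.replicate (Function.minimalPeriod p d) (lab d) := by
  rw [orbitLabels_mk, Multiset.eq_replicate]
  refine ⟨by simp, fun b hb => ?_⟩
  obtain ⟨i, -, rfl⟩ := Multiset.mem_map.1 hb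
  exact apply_pow_of_invariant h i d

theorem eq_of_sameCycle_of_invariant [Finite D] {p : Equiv.Perm D} {lab : D → L}
    (h : ∀ d, lab (p d) = lab d) {d e : D} (hde : p.SameCycle d e) : lab e = lab d := by
  obtain ⟨i, -, rfl⟩ := (sameCycle_iff_exists_lt p d e).1 hde
  exact apply_pow_of_invariant h i d

/-- With two admissible types, each containing only one label, the multiplicities follow from the
total count of each label. -/
theorem eq_replicate_add_replicate [DecidableEq L] {α β : L} (hαβ : α ≠ β) {j k a b : ℕ}
    (hj : 0 < j) (hk : 0 < k) {s : Multiset (Multiset L)}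
    (hs : ∀ m ∈ s, m = Multiset.replicate j α ∨ m = Multiset.replicate k β)
    (ha : s.sum.count α = a * j) (hb : s.sum.count β = b * k) :
    s = Multiset.replicate a (Multiset.replicate j α) +
      Multiset.replicate b (Multiset.replicate k β) := by
  obtain ⟨a', b', rfl⟩ : ∃ a' b', s = Multiset.replicate a' (Multiset.replicate j α) +
      Multiset.replicate b' (Multiset.replicate k β) := by
    clear ha hb
    induction s using Multiset.induction_on with
    | empty => exact ⟨0, 0, by simp⟩
    | cons m s ih =>
      obtain ⟨a', b', rfl⟩ := ih fun m hm => hs m (Multiset.mem_cons_of_mem hm)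
      rcases hs m (Multiset.mem_cons_self _ _) with rfl | rfl
      · exact ⟨a' + 1, b', by simp [Multiset.replicate_succ]⟩
      · exact ⟨a', b' + 1, by simp [Multiset.replicate_succ]⟩
  simp [Multiset.sum_replicate, Multiset.count_replicate, hαβ, hαβ.symm] at ha hb
  rw [ha.resolve_right hj.ne', hb.resolve_right hk.ne']

end

section PentSub

variable {E L : Type*} (N : OMap E)

theorem pentSub_next (d : E) (c : Corner) : (pentSub N).next (d, c) = (d, c.rot) := rfl

theorem pentSub_next_pow (i : ℕ) (d : E) (c : Corner) :
    ((pentSub N).next ^ i) (d, c) = (d, (Corner.rot ^ i) c) := by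
  induction i with
  | zero => rfl
  | succ i ih => rw [pow_succ', Equiv.Perm.mul_apply, ih, pentSub_next, pow_succ']; rfl

theorem pentSub_vert_α (d : E) : (pentSub N).vert (d, .α) = (N.opp (N.next⁻¹ d), .β) := rfl

theorem pentSub_vert_β (d : E) : (pentSub N).vert (d, .β) = (N.opp d, .γ) := rfl

theorem pentSub_vert_γ (d : E) : (pentSub N).vert (d, .γ) = (N.next d, .α) := rfl

theorem minimalPeriod_rot (c : Corner) : Function.minimalPeriod Corner.rot c = 5 := by
  have : Fact (Nat.Prime 5) := ⟨by norm_num⟩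
  apply Function.minimalPeriod_eq_prime
  · revert c; simp only [Function.IsPeriodicPt, Function.IsFixedPt]; decide
  · revert c; simp only [Function.IsFixedPt]; decide

theorem minimalPeriod_pentSub_next (x : E × Corner) :
    Function.minimalPeriod (pentSub N).next x = 5 := by
  obtain ⟨d, c⟩ := x
  rw [minimalPeriod_eq_of_semiconj (p := Corner.rot) (f := fun c => (d, c))
    (Prod.mk_right_injective d) (fun c => rfl), minimalPeriod_rot]

theorem minimalPeriod_opp (d : E) : Function.minimalPeriod N.opp d = 2 :=
  Function.minimalPeriod_eq_prime (N.opp_opp d) (N.opp_ne d)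

/-- The subdivision has three kinds of vertices: centres of tiles (`ε`), where the rotation is
`next⁻¹`; old vertices (`δ`), where it is the old `vert`; and division points of edges, where it
cycles `α`, `β`, `γ`. -/
theorem minimalPeriod_pentSub_vert_ε (d : E) :
    Function.minimalPeriod (pentSub N).vert (d, .ε) = Function.minimalPeriod N.next d := by
  rw [minimalPeriod_eq_of_semiconj (p := N.next⁻¹) (f := fun d => (d, Corner.ε))
    (Prod.mk_left_injective _) (fun c => rfl), minimalPeriod_inv]

theorem minimalPeriod_pentSub_vert_δ (d : E) :
    Function.minimalPeriod (pentSub N).vert (d, .δ) = Function.minimalPeriod N.vert d :=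
  minimalPeriod_eq_of_semiconj (p := N.vert) (f := fun d => (d, Corner.δ))
    (Prod.mk_left_injective _) (fun _ => rfl) d

theorem minimalPeriod_pentSub_vert_of_ne {x : E × Corner} (hε : x.2 ≠ .ε) (hδ : x.2 ≠ .δ) :
    Function.minimalPeriod (pentSub N).vert x = 3 := by
  have : Fact (Nat.Prime 3) := ⟨by norm_num⟩
  obtain ⟨d, c⟩ := x
  apply Function.minimalPeriod_eq_prime
  · rw [Function.IsPeriodicPt, Function.IsFixedPt]
    cases c <;> simp_all [pentSub_vert_α, pentSub_vert_β, pentSub_vert_γ, N.opp_opp]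
  · rw [Function.IsFixedPt]
    cases c <;> simp_all [pentSub_vert_α, pentSub_vert_β, pentSub_vert_γ]

variable {N}

/-- Crossing the edge `γ` realizes `next` on the base map, and crossing the edge `β` realizes `opp`.
-/
theorem OMap.Connected.pentSub [Finite E] [Nonempty E] (hN : N.Connected) :
    (pentSub N).Connected := by
  refine OMap.connected_of_forall_closed (Classical.arbitrary E, .ε) fun S ha hn ho => ?_
  have h1 : ∀ d, (d, Corner.ε) ∈ S → ∀ c, (d, c) ∈ S := by
    intro d hd c
    have hα := hn _ hd
    have hδ := hn _ hα
    have hβ := hn _ hδ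
    have hγ := hn _ hβ
    cases c <;> assumption
  have h2 : ∀ d, (d, Corner.β) ∈ S → (d, Corner.ε) ∈ S := fun d hd => hn _ (hn _ hd)
  have h3 : ∀ d, d ∈ {d | (d, Corner.ε) ∈ S} :=
    hN.mem_of_closed ha (fun d hd => ho _ (h1 d hd .γ)) fun d hd => h2 _ (ho _ (h1 d hd .β))
  exact fun x => h1 _ (h3 x.1) x.2

variable {α β : L}

theorem reduce2D_pentSub_vert (x : E × Corner) :
    reduce2D α β ((pentSub N).vert x).2 = reduce2D α β x.2 := by
  obtain ⟨d, c⟩ := x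
  cases c <;> rfl

theorem pentSub_cornerCongruent :
    (pentSub N).CornerCongruent fun x => reduce2D α β x.2 := by
  rintro ⟨d, c⟩ ⟨d', c'⟩
  refine ⟨(d', c), ?_, Or.inl fun i => by simp only [pentSub_next_pow]⟩
  have : ∀ c c', ∃ i < 5, (Corner.rot ^ i) c = c' := by decide
  obtain ⟨i, -, hi⟩ := this c' c
  exact ⟨i, by rw [zpow_natCast, pentSub_next_pow, hi]⟩

variable [Fintype E] {k : ℕ} (hk : 1 < k)
  (hn : ∀ d, Function.minimalPeriod N.next d = k) (hv : ∀ d, Function.minimalPeriod N.vert d = 3)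

include hk hn hv

/-- The rotation preserves the kinds `ε` and `δ`. Two distinct corners among `α`, `β`, `γ` of a tile
at one vertex would give a fixed point of `next`, `opp` or `vert`. -/
theorem pentSub_pentagonal : (pentSub N).Pentagonal := by
  constructor
  · intro x
    rw [natCard_sameCycle, minimalPeriod_pentSub_next]
  · rintro ⟨d, c⟩ ⟨d', c'⟩ h1 h2
    obtain rfl : d' = d := eq_of_sameCycle_of_invariant (lab := Prod.fst) (fun _ => rfl) h1
    have hn1 : N.next d' ≠ d' := fun h => by
      have := (Function.minimalPeriod_eq_one_iff_isFixedPt (f := N.next)).2 h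
      have := hn d'
      omega
    have hn2 : N.next⁻¹ d' ≠ d' := fun h => hn1 (Equiv.Perm.inv_eq_iff_eq.1 h).symm
    have hv1 : ∀ d, N.next (N.opp d) ≠ d := fun d h => by
      have := (Function.minimalPeriod_eq_one_iff_isFixedPt (f := N.vert)).2 h
      have := hv d
      omega
    have hv2 : N.opp (N.next⁻¹ d') ≠ d' := fun h => by
      apply hv1 d'
      conv_lhs => rw [← h, N.opp_opp]
      simp
    have ho : ∀ d, N.opp d ≠ d := N.opp_ne
    by_cases hε : c = .ε
    · have := eq_of_sameCycle_of_invariant (lab := fun x : E × Corner => decide (x.2 = .ε))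
        (by rintro ⟨d, c⟩; cases c <;> rfl) h2
      simp_all
    by_cases hδ : c = .δ
    · have := eq_of_sameCycle_of_invariant (lab := fun x : E × Corner => decide (x.2 = .δ))
        (by rintro ⟨d, c⟩; cases c <;> rfl) h2
      simp_all
    obtain ⟨i, hi, he⟩ := (sameCycle_iff_exists_lt _ _ _).1 h2
    rw [minimalPeriod_pentSub_vert_of_ne N hε hδ] at hi
    interval_cases i
    · simpa using he
    all_goals
      cases c <;>
      simp_all [pow_succ, pentSub_vert_α, pentSub_vert_β, pentSub_vert_γ, N.opp_opp]

/-- `ha` and `hb` count the corners `α` and `β`; `hχ` is Euler's relation with `V = a + b`, `F = n`,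
`2E = 5n`. -/
theorem isTilingFor_pentSub [Nonempty E] (hαβ : α ≠ β) {n a b : ℕ} (hcard : Fintype.card E = n)
    (hN : N.Connected) (ha : a * 3 = n * 4) (hb : b * k = n) (hχ : 2 * (a + b) = 3 * n + 4) :
    IsTilingFor (pentSub N) (fun x => reduce2D α β x.2)
      ⟨Multiset.replicate n {α, α, α, α, β}, Multiset.replicate a (Multiset.replicate 3 α) +
        Multiset.replicate b (Multiset.replicate k β)⟩ := by
  classical
  have hc : Fintype.card (E × Corner) = n * 5 := by
    rw [Fintype.card_prod, hcard]; rfl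
  have hcn : Nat.card (Orbit (pentSub N).next) = n := by
    have := natCard_orbit_mul _ (minimalPeriod_pentSub_next N)
    omega
  have hco := natCard_orbit_mul _ (minimalPeriod_opp (pentSub N))
  have htiles : combinations (pentSub N).next (fun x => reduce2D α β x.2) =
      Multiset.replicate n {α, α, α, α, β} := by
    rw [Multiset.eq_replicate, ← natCard_orbit]
    refine ⟨hcn, fun m hm => ?_⟩
    obtain ⟨⟨d, c⟩, rfl⟩ := exists_of_mem_combinations hm
    rw [orbitLabels_mk, minimalPeriod_pentSub_next]
    simp only [pentSub_next_pow]
    -- Boolean labels make the claim decidable; `cond` then carries it over to `L`.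
    have h : ∀ c, (Multiset.range 5).map (fun i => reduce2D false true ((Corner.rot ^ i) c)) =
        {false, false, false, false, true} := by decide
    have := congrArg (Multiset.map fun t => cond t β α) (h c)
    rw [Multiset.map_map] at this
    have hr : ∀ c, reduce2D α β c = cond (reduce2D false true c) β α := by
      intro c; cases c <;> rfl
    exact Eq.trans (Multiset.map_congr rfl fun i _ => hr _) this
  have hverts : combinations (pentSub N).vert (fun x => reduce2D α β x.2) =
      Multiset.replicate a (Multiset.replicate 3 α) +
        Multiset.replicate b (Multiset.replicate k β) := by
    have hs := (sum_combinations (pentSub N).vert (fun x => reduce2D α β x.2)).trans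
      (sum_combinations (pentSub N).next (fun x => reduce2D α β x.2)).symm
    rw [htiles, Multiset.sum_replicate] at hs
    refine eq_replicate_add_replicate hαβ (by norm_num) (by omega) (fun m hm => ?_) ?_ ?_
    · obtain ⟨⟨d, c⟩, rfl⟩ := exists_of_mem_combinations hm
      rw [orbitLabels_of_invariant reduce2D_pentSub_vert]
      by_cases hε : c = .ε
      · subst hε
        rw [minimalPeriod_pentSub_vert_ε, hn]
        exact Or.inr rfl
      · left
        have : reduce2D α β c = α := by cases c <;> simp_all [reduce2D]
        rw [this]
        by_cases hδ : c = .δ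
        · subst hδ
          rw [minimalPeriod_pentSub_vert_δ, hv]
        · rw [minimalPeriod_pentSub_vert_of_ne N hε hδ]
    · rw [hs, ha]
      simp [hαβ]
    · rw [hs, hb]
      simp [hαβ.symm]
  refine ⟨⟨hN.pentSub, ?_⟩, pentSub_pentagonal hk hn hv, pentSub_cornerCongruent, htiles, hverts⟩
  rw [natCard_orbit _ (fun x : E × Corner => reduce2D α β x.2), hverts, hcn]
  simp only [Multiset.card_add, Multiset.card_replicate]
  omega

end PentSub

end SphereTiling

/-! ### Invariance under isomorphism and reflection -/

namespace SphereTiling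

section Transport

variable {D D' L : Type*} [Fintype D] [Fintype D'] {M : OMap D} {M' : OMap D'} {lab : D → L}
  {lab' : D' → L} {A : AVC L}

theorem IsTilingFor.of_equiv (h : IsTilingFor M' lab' A) (e : D ≃ D')
    (hl : ∀ d, lab' (e d) = lab d) (hn : ∀ d, e (M.next d) = M'.next (e d))
    (ho : ∀ d, e (M.opp d) = M'.opp (e d)) : IsTilingFor M lab A := by
  have hv : ∀ d, e (M.vert d) = M'.vert (e d) := fun d => by
    simp [OMap.vert, hn, ho]
  have hnS := sameCycle_congr e hn
  have hvS := sameCycle_congr e hv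
  have hoS := sameCycle_congr e ho
  have hpow : ∀ (k : ℕ) d, e ((M.next ^ k) d) = (M'.next ^ k) (e d) := fun k d => by
    induction k with
    | zero => rfl
    | succ k ih => simp only [pow_succ', Equiv.Perm.mul_apply, hn, ih]
  have hn' : ∀ d, e (M.next⁻¹ d) = M'.next⁻¹ (e d) := fun d => by
    rw [Equiv.Perm.eq_inv_iff_eq, ← hn]
    simp
  have hpow' : ∀ (k : ℕ) d, e ((M.next⁻¹ ^ k) d) = (M'.next⁻¹ ^ k) (e d) := fun k d => by
    induction k with
    | zero => rfl
    | succ k ih => simp only [pow_succ', Equiv.Perm.mul_apply, hn', ih]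
  refine ⟨⟨?_, ?_⟩, ⟨fun d => ?_, fun d d' h1 h2 => ?_⟩, fun d d' => ?_, ?_, ?_⟩
  · intro a b
    refine OMap.connected_of_forall_closed a (fun S ha hSn hSo d => ?_) a b
    have := h.sphere.1.mem_of_closed (S := e.symm ⁻¹' S) (a := e a) (by simpa using ha)
      (fun d hd => ?_) (fun d hd => ?_) (e d)
    · simpa using this
    · obtain ⟨d, rfl⟩ := e.surjective d
      rw [← hn]
      simp only [Set.mem_preimage, Equiv.symm_apply_apply] at hd ⊢
      exact hSn _ hd
    · obtain ⟨d, rfl⟩ := e.surjective d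
      rw [← ho]
      simp only [Set.mem_preimage, Equiv.symm_apply_apply] at hd ⊢
      exact hSo _ hd
  · rw [Nat.card_congr (orbitEquiv e hnS), Nat.card_congr (orbitEquiv e hvS),
      Nat.card_congr (orbitEquiv e hoS)]
    exact h.sphere.2
  · rw [natCard_sameCycle, ← minimalPeriod_eq_of_semiconj e.injective hn, ← natCard_sameCycle]
    exact h.pentagonal.1 _
  · exact e.injective (h.pentagonal.2 _ _ ((hnS _ _).1 h1) ((hvS _ _).1 h2))
  · obtain ⟨x, hx, hx'⟩ := h.congruent (e d) (e d')
    obtain ⟨x, rfl⟩ := e.surjective x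
    refine ⟨x, (hnS _ _).2 hx, ?_⟩
    simpa only [← hpow, ← hpow', hl] using hx'
  · rw [combinations_congr e hnS hl, h.tiles]
  · rw [combinations_congr e hvS hl, h.vertices]

omit [Fintype D] in
theorem OMap.Pentagonal.next_pow_five [Finite D] (h : M.Pentagonal) : M.next ^ 5 = 1 := by
  ext d
  have := h.1 d
  rw [natCard_sameCycle] at this
  exact pow_eq_self_of_minimalPeriod_eq this

theorem IsTilingFor.mirror (h : IsTilingFor M lab A) : IsTilingFor M.mirror lab A := by
  have hn : M.mirror.next = M.next⁻¹ := rfl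
  have hnS : ∀ a b, M.mirror.next.SameCycle a b ↔ M.next.SameCycle a b := fun a b => by
    rw [hn, Equiv.Perm.sameCycle_inv]
  have hvS : ∀ a b, M.mirror.vert.SameCycle a b ↔ M.vert.SameCycle a b := fun a b => by
    rw [M.vert_mirror, Equiv.Perm.sameCycle_inv]
  have hoS := sameCycle_congr (p := M.opp) (p' := M.mirror.opp) M.next
    (fun d => by simp [OMap.mirror])
  have h5 := h.pentagonal.next_pow_five
  have h4 : M.next⁻¹ = M.next ^ 4 := by
    rw [inv_eq_iff_mul_eq_one, ← pow_succ', h5]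
  refine ⟨⟨h.sphere.1.mirror, ?_⟩, ⟨fun d => ?_, fun d d' h1 h2 => ?_⟩, fun d d' => ?_, ?_, ?_⟩
  · rw [Nat.card_congr (orbitEquiv (Equiv.refl D) hnS),
      Nat.card_congr (orbitEquiv (Equiv.refl D) hvS), ← Nat.card_congr (orbitEquiv M.next hoS)]
    exact h.sphere.2
  · simp only [hnS]
    exact h.pentagonal.1 _
  · exact h.pentagonal.2 _ _ ((hnS _ _).1 h1) ((hvS _ _).1 h2)
  · obtain ⟨x, hx, hx'⟩ := h.congruent d d'
    refine ⟨x, (hnS _ _).2 hx, ?_⟩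
    rw [hn]
    -- As `next⁻¹ = next ^ 4`, agreement at the exponents `4 * k` is agreement in the reversed
    -- direction.
    refine hx'.imp (fun hx' k => ?_) fun hx' k => ?_
    · rw [h4, ← pow_mul, hx']
    · have := hx' (4 * k)
      rw [pow_mul, ← h4, pow_mul, inv_pow _ 4, ← h4] at this
      exact this
  · exact (combinations_congr (Equiv.refl D) hnS fun _ => rfl).trans h.tiles
  · exact (combinations_congr (Equiv.refl D) hvS fun _ => rfl).trans h.vertices

omit [Fintype D] [Fintype D'] in
-- Since `vert = next * opp`, a bijection compatible with `next` respects `vert` exactly when it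
-- respects `opp`; reversing the cyclic orders means mapping to the mirror image.
theorem sameTiling_iff : SameTiling M lab M' lab' ↔ ∃ e : D ≃ D', (∀ d, lab' (e d) = lab d) ∧
    (((∀ d, e (M.next d) = M'.next (e d)) ∧ ∀ d, e (M.opp d) = M'.opp (e d)) ∨
      ((∀ d, e (M.next d) = M'.mirror.next (e d)) ∧
        ∀ d, e (M.opp d) = M'.mirror.opp (e d))) := by
  have key : ∀ (e : D ≃ D') (M' : OMap D'), (∀ d, e (M.next d) = M'.next (e d)) →
      ((∀ d, e (M.vert d) = M'.vert (e d)) ↔ ∀ d, e (M.opp d) = M'.opp (e d)) := by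
    intro e M' hn
    simp [OMap.vert, hn]
  refine exists_congr fun e => and_congr_right fun _ => or_congr ?_ ?_
  · exact and_congr_right fun hn => key e M' hn
  · refine and_congr_right fun hn => ?_
    rw [← key e M'.mirror hn, M'.vert_mirror]
    rfl

theorem IsTilingFor.of_sameTiling (h : IsTilingFor M' lab' A) (hs : SameTiling M lab M' lab') :
    IsTilingFor M lab A := by
  obtain ⟨e, hl, ⟨hn, ho⟩ | ⟨hn, ho⟩⟩ := sameTiling_iff.1 hs
  · exact h.of_equiv e hl hn ho
  · exact h.mirror.of_equiv e hl hn ho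

omit [Fintype D] [Fintype D'] in
theorem SameTiling.of_mirror (h : SameTiling M.mirror lab M' lab') : SameTiling M lab M' lab' := by
  obtain ⟨e, hl, h⟩ := h
  refine ⟨e, hl, h.symm.imp (fun h => ?_) fun h => ?_⟩
  · rw [M.vert_mirror] at h
    refine ⟨fun d => ?_, fun d => ?_⟩
    · have := h.1 (M.next d)
      rw [Equiv.eq_symm_apply] at this
      simpa [OMap.mirror] using this.symm
    · have := h.2 (M.vert d)
      rw [Equiv.eq_symm_apply] at this
      simpa using this.symm
  · rw [M.vert_mirror] at h
    refine ⟨fun d => ?_, fun d => ?_⟩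
    · have := h.1 (M.next d)
      rw [Equiv.eq_symm_apply]
      simpa [OMap.mirror] using this.symm
    · have := h.2 (M.vert d)
      rw [Equiv.eq_symm_apply]
      simpa using this.symm

end Transport

/-! ### The two Platonic maps and their subdivisions -/

section Platonic

theorem cube_connected : cube.Connected := by
  refine OMap.connected_of_forall_closed (.top, 0) fun S ha hn ho => ?_
  have h : ∀ F, (F, 0) ∈ S → ∀ j, (F, j) ∈ S := by
    intro F h0 j
    have h1 := hn _ h0
    have h2 := hn _ h1
    have h3 := hn _ h2
    fin_cases j <;> assumption
  have hs : ∀ i j, (CubeFace.side i, j) ∈ S := fun i => h _ (ho _ (h _ ha i))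
  have hb : (CubeFace.bottom, 0) ∈ S := hn _ (ho _ (hs 0 2))
  rintro ⟨_ | i | _, j⟩
  exacts [h _ ha j, hs i j, h _ hb j]

theorem dodecahedron_connected : dodecahedron.Connected := by
  refine OMap.connected_of_forall_closed (.top, 0) fun S ha hn ho => ?_
  have h : ∀ F, (F, 0) ∈ S → ∀ j, (F, j) ∈ S := by
    intro F h0 j
    have h1 := hn _ h0
    have h2 := hn _ h1
    have h3 := hn _ h2
    have h4 := hn _ h3
    fin_cases j <;> assumption
  have hu : ∀ i j, (DodecFace.upper i, j) ∈ S := fun i => h _ (ho _ (h _ ha i))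
  have hl : ∀ i j, (DodecFace.lower i, j) ∈ S := fun i => h _ <| by
    have : dodecahedron.next (dodecahedron.opp (.upper i, 2)) = (.lower i, 0) := by
      revert i; decide
    exact this ▸ hn _ (ho _ (hu i 2))
  have hb := h _ (ho _ (hl 0 2))
  rintro ⟨_ | i | i | _, j⟩
  exacts [h _ ha j, hu i j, hl i j, hb j]

theorem minimalPeriod_cube_next (d : CubeFace × Fin 4) :
    Function.minimalPeriod cube.next d = 4 := by
  have : Fact (Nat.Prime 2) := ⟨by norm_num⟩
  -- The period is `4 = 2 ^ (1 + 1)`.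
  apply Function.minimalPeriod_eq_prime_pow (p := 2) (k := 1)
  · revert d; simp only [Function.IsPeriodicPt, Function.IsFixedPt]; decide
  · revert d; simp only [Function.IsPeriodicPt, Function.IsFixedPt]; decide

theorem minimalPeriod_cube_vert (d : CubeFace × Fin 4) :
    Function.minimalPeriod cube.vert d = 3 := by
  have : Fact (Nat.Prime 3) := ⟨by norm_num⟩
  apply Function.minimalPeriod_eq_prime
  · revert d; simp only [Function.IsPeriodicPt, Function.IsFixedPt]; decide
  · revert d; simp only [Function.IsFixedPt]; decide

theorem minimalPeriod_dodecahedron_next (d : DodecFace × Fin 5) :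
    Function.minimalPeriod dodecahedron.next d = 5 := by
  have : Fact (Nat.Prime 5) := ⟨by norm_num⟩
  apply Function.minimalPeriod_eq_prime
  · revert d; simp only [Function.IsPeriodicPt, Function.IsFixedPt]; decide
  · revert d; simp only [Function.IsFixedPt]; decide

theorem minimalPeriod_dodecahedron_vert (d : DodecFace × Fin 5) :
    Function.minimalPeriod dodecahedron.vert d = 3 := by
  have : Fact (Nat.Prime 3) := ⟨by norm_num⟩
  apply Function.minimalPeriod_eq_prime
  · revert d; simp only [Function.IsPeriodicPt, Function.IsFixedPt]; decide
  · revert d; simp only [Function.IsFixedPt]; decide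

variable {L : Type*} {α β : L}

theorem isTilingFor_PP6 (hαβ : α ≠ β) :
    IsTilingFor PP6 (fun c => reduce2D α β c.2) (avc2D24 α β) :=
  have : Nonempty (CubeFace × Fin 4) := ⟨(.top, 0)⟩
  isTilingFor_pentSub (by norm_num) minimalPeriod_cube_next minimalPeriod_cube_vert hαβ
    (by decide) cube_connected (by norm_num) (by norm_num) (by norm_num)

theorem isTilingFor_PP12 (hαβ : α ≠ β) :
    IsTilingFor PP12 (fun c => reduce2D α β c.2) (avc2D60 α β) :=
  have : Nonempty (DodecFace × Fin 5) := ⟨(.top, 0)⟩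
  isTilingFor_pentSub (by norm_num) minimalPeriod_dodecahedron_next
    minimalPeriod_dodecahedron_vert hαβ
    (by decide) dodecahedron_connected (by norm_num) (by norm_num) (by norm_num)

end Platonic

end SphereTiling

/-! ### Local analysis of the gluing -/

namespace SphereTiling

/-- The local consequences of `AVC = {α⁴β : α³, βᵏ}`. -/
structure LocalTiling {D L : Type*} (M : OMap D) (lab : D → L) (β : L) (k : ℕ) : Prop where
  connected : M.Connected
  next_five : ∀ d, M.next (M.next (M.next (M.next (M.next d)))) = d
  exists_tile : ∀ d, ∃ b, lab b = β ∧ (d = b ∨ d = M.next b ∨ d = M.next (M.next b) ∨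
    d = M.next (M.next (M.next b)) ∨ d = M.next (M.next (M.next (M.next b))))
  lab_one : ∀ b, lab b = β → lab (M.next b) ≠ β
  lab_two : ∀ b, lab b = β → lab (M.next (M.next b)) ≠ β
  lab_vert : ∀ d, lab (M.next (M.opp d)) = lab d
  vert_three : ∀ d, lab d ≠ β → M.next (M.opp (M.next (M.opp (M.next (M.opp d))))) = d
  vert_pow : ∀ d, lab d = β → (M.vert ^ k) d = d

namespace LocalTiling

variable {D L : Type*} {M : OMap D} {lab : D → L} {β : L} {k : ℕ}

section

variable (h : LocalTiling M lab β k)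

include h

theorem lab_three {b : D} (hb : lab b = β) : lab (M.next (M.next (M.next b))) ≠ β := fun h3 =>
  h.lab_two _ h3 (by rw [h.next_five, hb])

theorem lab_four {b : D} (hb : lab b = β) :
    lab (M.next (M.next (M.next (M.next b)))) ≠ β := fun h4 =>
  h.lab_one _ h4 (by rw [h.next_five, hb])

theorem opp_zero (d : D) :
    M.opp d = M.next (M.next (M.next (M.next (M.next (M.opp d))))) := (h.next_five _).symm

theorem lab_opp (d : D) : lab (M.opp d) = lab (M.next d) := by
  rw [← h.lab_vert, M.opp_opp]

/-- `opp (next⁴ b)` is `vert⁻¹ b`, and is written in this form throughout. -/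
theorem lab_opp_four {b : D} (hb : lab b = β) :
    lab (M.opp (M.next (M.next (M.next (M.next b))))) = β := by
  rw [← h.lab_vert, M.opp_opp, h.next_five, hb]

theorem next_opp_opp_four (b : D) :
    M.next (M.opp (M.opp (M.next (M.next (M.next (M.next b)))))) = b := by
  rw [M.opp_opp, h.next_five]

end

/-- The edge that follows the edge from the corner `β` in the tile of `b` is glued to the second
one in another tile. -/
def Twisted (M : OMap D) (lab : D → L) (β : L) (b : D) : Prop :=
  ∃ c, lab c = β ∧ M.opp (M.next b) = M.next (M.next c)

section

variable (h : LocalTiling M lab β k) {b c : D}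

include h

/-- Both ends of edge 1 are corners `α`, which excludes edges 0 and 4. If it met an edge 3, the
third tile at the vertex would have `β` at positions 0 and 2. -/
theorem twisted_or (hb : lab b = β) :
    Twisted M lab β b ∨ ∃ c, lab c = β ∧ M.opp (M.next b) = M.next c := by
  obtain ⟨c, hc, h0 | h1 | h2 | h3 | h4⟩ := h.exists_tile (M.opp (M.next b))
  · exfalso
    apply h.lab_two b hb
    rw [← h.lab_opp, h0, hc]
  · exact Or.inr ⟨c, hc, h1⟩
  · exact Or.inl ⟨c, hc, h2⟩
  · exfalso
    have hv := h.vert_three (M.next b) (h.lab_one b hb)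
    rw [h3] at hv
    have hc' := h.lab_opp_four hc
    apply h.lab_two _ hc'
    rw [← h.lab_opp, M.next.injective hv, hb]
  · exfalso
    apply h.lab_one b hb
    rw [← h.lab_vert, h4, h.next_five, hc]

/-- Closing up the degree-three vertex of `next b` determines the third edge there. Note that `next⁴
(opp b)` is edge 3 of the tile of `vert b`. -/
theorem opp_three_of_twisted (hb : lab b = β) (hbc : M.opp (M.next b) = M.next (M.next c)) :
    M.opp (M.next (M.next (M.next c))) = M.next (M.next (M.next (M.next (M.opp b)))) := by
  have hv := h.vert_three (M.next b) (h.lab_one b hb)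
  rw [hbc] at hv
  have := congrArg M.opp (M.next.injective hv)
  rw [M.opp_opp, h.opp_zero b] at this
  exact M.next.injective this

theorem opp_two_of_not_twisted (hb : lab b = β) (hbc : M.opp (M.next b) = M.next c) :
    M.opp (M.next (M.next c)) = M.next (M.next (M.next (M.next (M.opp b)))) := by
  have hv := h.vert_three (M.next b) (h.lab_one b hb)
  rw [hbc] at hv
  have := congrArg M.opp (M.next.injective hv)
  rw [M.opp_opp, h.opp_zero b] at this
  exact M.next.injective this

/-- If the tile of `b` is twisted, so is the tile that follows the tile of `c` around its vertex
`β`. -/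
theorem twisted_opp_four (hb : lab b = β) (hc : lab c = β)
    (hbc : M.opp (M.next b) = M.next (M.next c)) :
    M.opp (M.next (M.opp (M.next (M.next (M.next (M.next c)))))) =
      M.next (M.next (M.next (M.opp b))) := by
  have hc' := h.lab_opp_four hc
  have h3 := h.opp_three_of_twisted hb hbc
  -- In the twisted case, edge 3 of `z` and edge 3 of `vert b` are both glued to `next³ c`, so `z =
  -- vert b`. Otherwise `z` would be `next (vert b)`, which is not a corner `β`.
  rcases h.twisted_or hc' with ⟨z, hz, hz'⟩ | ⟨z, hz, hz'⟩
  · have h3' := h.opp_three_of_twisted hc' hz'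
    rw [M.opp_opp, h.next_five] at h3'
    rw [hz']
    have := congrArg M.opp h3'
    rw [M.opp_opp, h3] at this
    rw [M.next.injective this]
  · exfalso
    have h2' := h.opp_two_of_not_twisted hc' hz'
    rw [M.opp_opp, h.next_five] at h2'
    have := congrArg M.opp h2'
    rw [M.opp_opp, h3] at this
    have h4 := M.next.injective (M.next.injective this)
    exact h.lab_one _ ((h.lab_vert b).trans hb) (by rw [← h4, hz])

/-- At corner 2 of the tile of `t = vert b`, edge 2 is glued to edge 1 of `b' = vert⁻¹ c`. Closing
up this vertex with `t` untwisted would glue edge 2 of `b'`, which ends at an `α`, to an edge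
starting at a `β`. -/
theorem Twisted.vert (ht : Twisted M lab β b) (hb : lab b = β) :
    Twisted M lab β (M.next (M.opp b)) := by
  obtain ⟨c, hc, hbc⟩ := ht
  have h4 := h.twisted_opp_four hb hc hbc
  set b' := M.opp (M.next (M.next (M.next (M.next c))))
  have hlb' : lab b' = β := h.lab_opp_four hc
  set t := M.next (M.opp b)
  have hlt : lab t = β := (h.lab_vert b).trans hb
  have hv := h.vert_three (M.next (M.next t)) (h.lab_two t hlt)
  -- This changes both sides; the next rewriting restores the right one.
  rw [← h4, M.opp_opp] at hv
  rw [h4] at hv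
  have := congrArg M.opp (M.next.injective hv)
  rw [M.opp_opp] at this
  rcases h.twisted_or hlt with h' | ⟨z, hz, hz'⟩
  · exact h'
  · exfalso
    rw [hz'] at this
    apply h.lab_three hlb'
    rw [← h.lab_opp, M.next.injective this, hz]

theorem Twisted.of_vert [Finite D] (ht : Twisted M lab β b) (hb : lab b = β) :
    Twisted M lab β (M.opp (M.next (M.next (M.next (M.next b))))) := by
  have h1 := (Equiv.Perm.perm_symm_on_of_perm_on_finite (f := M.vert)
    (p := fun d => lab d = β ∧ Twisted M lab β d)
    (fun d hd => ⟨(h.lab_vert d).trans hd.1, Twisted.vert h hd.2 hd.1⟩) ⟨hb, ht⟩).2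
  have h2 : M.vert.symm b = M.opp (M.next (M.next (M.next (M.next b)))) := by
    rw [Equiv.symm_apply_eq]
    exact (h.next_opp_opp_four b).symm
  rwa [h2] at h1

theorem twisted_of_opp_eq (hb : lab b = β) (hc : lab c = β)
    (hbc : M.opp (M.next b) = M.next (M.next c)) : Twisted M lab β c := by
  have hc' := h.lab_opp_four hc
  have h1 : Twisted M lab β (M.opp (M.next (M.next (M.next (M.next c))))) :=
    ⟨_, (h.lab_vert b).trans hb, h.twisted_opp_four hb hc hbc⟩
  have := Twisted.vert h h1 hc'
  rwa [h.next_opp_opp_four] at this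

theorem eq_of_mem_tile (hb : lab b = β) (hc : lab c = β) (hbc : b = c ∨ b = M.next c ∨
    b = M.next (M.next c) ∨ b = M.next (M.next (M.next c)) ∨
    b = M.next (M.next (M.next (M.next c)))) : b = c := by
  rcases hbc with rfl | rfl | rfl | rfl | rfl
  · rfl
  · exact absurd hb (h.lab_one _ hc)
  · exact absurd hb (h.lab_two _ hc)
  · exact absurd hb (h.lab_three hc)
  · exact absurd hb (h.lab_four hc)

theorem twisted_of_twisted [Finite D] {a : D} (ht : Twisted M lab β a) (ha : lab a = β)
    (hc : lab c = β) : Twisted M lab β c := by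
  have key := h.connected.mem_of_closed (S := {d | ∃ b, lab b = β ∧ Twisted M lab β b ∧
    (d = b ∨ d = M.next b ∨ d = M.next (M.next b) ∨ d = M.next (M.next (M.next b)) ∨
      d = M.next (M.next (M.next (M.next b))))}) ⟨a, ha, ht, Or.inl rfl⟩ ?_ ?_ c
  · obtain ⟨b', hb', ht', hcb⟩ := key
    rwa [h.eq_of_mem_tile hc hb' hcb]
  · rintro _ ⟨b, hb, ht, rfl | rfl | rfl | rfl | rfl⟩
    · exact ⟨_, hb, ht, by tauto⟩
    · exact ⟨b, hb, ht, by tauto⟩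
    · exact ⟨b, hb, ht, by tauto⟩
    · exact ⟨b, hb, ht, by tauto⟩
    · exact ⟨b, hb, ht, Or.inl (h.next_five b)⟩
  · rintro _ ⟨b, hb, ht, hd⟩
    have hb' := h.lab_opp_four hb
    have ht' := Twisted.of_vert h ht hb
    obtain ⟨c, hc, hbc⟩ := id ht'
    have h2 := h.twisted_opp_four hb' hc hbc
    have h3 := h.opp_three_of_twisted hb' hbc
    rw [M.opp_opp, h.next_five] at h3
    rw [h.next_opp_opp_four] at h2
    have htc := h.twisted_of_opp_eq hb' hc hbc
    -- Across edges 0, …, 4 lie the tiles of `vert b`, the partner of `b`, `vert⁻¹ c`, `c` and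
    -- `vert⁻¹ b`, where `c` is the partner of `vert⁻¹ b`.
    rcases hd with rfl | rfl | rfl | rfl | rfl
    · exact ⟨_, (h.lab_vert _).trans hb, Twisted.vert h ht hb, by
        right; right; right; right; exact h.opp_zero _⟩
    · obtain ⟨c, hc, hbc⟩ := id ht
      exact ⟨c, hc, h.twisted_of_opp_eq hb hc hbc, by tauto⟩
    · exact ⟨_, h.lab_opp_four hc, Twisted.of_vert h htc hc, by
        right; left; rw [← h2, M.opp_opp]⟩
    · exact ⟨c, hc, htc, by right; right; right; left; rw [← h3, M.opp_opp]⟩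
    · exact ⟨_, hb', ht', Or.inl rfl⟩

/-- Reflection exchanges the positions `i` and `5 - i` in a tile, so `lab_four` and `lab_three`
supply `lab_one` and `lab_two`. -/
theorem mirror [Finite D] : LocalTiling M.mirror lab β k := by
  have hinv : ∀ d, M.next⁻¹ d = M.next (M.next (M.next (M.next d))) := fun d => by
    rw [Equiv.Perm.inv_eq_iff_eq, h.next_five]
  have hn : M.mirror.next = M.next⁻¹ := rfl
  have hlv : ∀ d, lab (M.vert⁻¹ d) = lab d := fun d => by
    have h0 : M.vert (M.vert⁻¹ d) = d := M.vert.apply_symm_apply d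
    conv_rhs => rw [← h0]
    exact (h.lab_vert _).symm
  have hv : ∀ d, M.next⁻¹ (M.mirror.opp d) = M.vert⁻¹ d := fun d => by
    rw [← M.vert_mirror]; rfl
  have hv3 : ∀ d, lab d ≠ β → (M.vert ^ 3) d = d := h.vert_three
  refine ⟨h.connected.mirror, fun d => ?_, fun d => ?_, fun b hb => ?_, fun b hb => ?_,
    fun d => ?_, fun d hd => ?_, fun d hd => ?_⟩
  · simp only [hn, hinv, h.next_five]
  · obtain ⟨b, hb, hd⟩ := h.exists_tile d
    refine ⟨b, hb, ?_⟩
    simp only [hn, hinv, h.next_five]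
    tauto
  · rw [hn, hinv]
    exact h.lab_four hb
  · simp only [hn, hinv, h.next_five]
    exact h.lab_three hb
  · rw [hn, hv, hlv]
  · simp only [hn, hv]
    rw [← Equiv.Perm.mul_apply, ← Equiv.Perm.mul_apply, ← pow_two, ← pow_succ, inv_pow,
      Equiv.Perm.inv_eq_iff_eq, hv3 d hd]
  · rw [M.vert_mirror, inv_pow, Equiv.Perm.inv_eq_iff_eq, h.vert_pow d hd]

/-- In a tiling or in its mirror image, all the tiles are twisted. -/
theorem forall_twisted_or_mirror [Finite D] : (∀ b, lab b = β → Twisted M lab β b) ∨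
    ∀ b, lab b = β → Twisted M.mirror lab β b := by
  by_cases hD : ∀ b, lab b = β → Twisted M lab β b
  · exact Or.inl hD
  · right
    push Not at hD
    obtain ⟨b, hb, hbt⟩ := hD
    obtain ⟨c, hc, hbc⟩ := (h.twisted_or hb).resolve_left hbt
    have h2 := congrArg M.opp (h.opp_two_of_not_twisted hb hbc)
    rw [M.opp_opp] at h2
    -- Edge `i` becomes edge `4 - i` in the mirror image, so edge 3 of `vert b` glued to edge 2 of
    -- `c` reads as edge 1 glued to edge 2.
    have ht : Twisted M.mirror lab β (M.next (M.opp b)) := by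
      refine ⟨c, hc, ?_⟩
      have hinv : ∀ d, M.next⁻¹ d = M.next (M.next (M.next (M.next d))) := fun d => by
        rw [Equiv.Perm.inv_eq_iff_eq, h.next_five]
      simp only [OMap.mirror, Equiv.Perm.mul_apply, hinv, h.next_five]
      rw [← h2]
    exact fun c hc => h.mirror.twisted_of_twisted ht ((h.lab_vert b).trans hb) hc

end

end LocalTiling

end SphereTiling

/-! ### Reconstruction of the subdivided map -/

namespace SphereTiling

theorem OMap.Connected.of_pentSub {E : Type*} [Finite E] {N : OMap E}
    (h : (SphereTiling.pentSub N).Connected) : N.Connected := by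
  intro a b
  refine OMap.connected_of_forall_closed a (fun S ha hn ho => ?_) a b
  have hn' : ∀ d ∈ S, N.next.symm d ∈ S :=
    fun d hd => Equiv.Perm.perm_symm_mapsTo_of_mapsTo N.next (s := S) hn hd
  intro d
  refine h.mem_of_closed (S := {x | x.1 ∈ S}) (a := (a, .ε)) ha (fun x hx => hx) ?_ (d, .ε)
  rintro ⟨d, c⟩ hd
  cases c
  exacts [ho _ (hn' _ hd), ho _ hd, hn _ hd, hn _ (ho _ hd), hn' _ hd]

/-- Isomorphic maps have isomorphic pentagonal subdivisions. -/
theorem pentSub_congr {D E : Type*} {M : OMap D} {N : OMap E} {e : D → E}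
    (hn : ∀ d, e (M.next d) = N.next (e d)) (ho : ∀ d, e (M.opp d) = N.opp (e d))
    (x : D × Corner) :
    Prod.map e id ((pentSub M).opp x) = (pentSub N).opp (Prod.map e id x) := by
  have hn' : ∀ d, e (M.next.symm d) = N.next.symm (e d) := fun d => by
    rw [Equiv.eq_symm_apply, ← hn, Equiv.apply_symm_apply]
  obtain ⟨d, c⟩ := x
  cases c <;> simp [pentSub, pentSubOpp, hn, ho, hn']

/-- A tiling all of whose tiles are twisted is the pentagonal subdivision of the map whose oriented
edges are the tiles, a tile being identified with its corner `β`. -/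
theorem exists_pentSub_equiv_of_twisted {D L : Type*} [Fintype D] {M : OMap D} {lab : D → L}
    {β : L} {k : ℕ} (h : LocalTiling M lab β k)
    (ht : ∀ b, lab b = β → LocalTiling.Twisted M lab β b) :
    ∃ (N : OMap {d // lab d = β}) (e : {d // lab d = β} × Corner ≃ D),
      (∀ x, e ((pentSub N).next x) = M.next (e x)) ∧ (∀ x, e ((pentSub N).opp x) = M.opp (e x)) ∧
      (∀ x, lab (e x) = β ↔ x.2 = .ε) ∧ (∀ d, (N.next ^ k) d = d) ∧
      (∀ d, (N.vert ^ 3) d = d) ∧ N.Connected := by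
  -- Twistedness of `vert⁻¹ b` shows that edge 3 of `b` meets an edge 3.
  have h3 : ∀ b, lab b = β → ∃ c, lab c = β ∧ M.opp (M.next (M.next (M.next b))) =
      M.next (M.next (M.next c)) := by
    intro b hb
    obtain ⟨c, hc, hbc⟩ := ht _ (h.lab_opp_four hb)
    have := h.opp_three_of_twisted (h.lab_opp_four hb) hbc
    rw [M.opp_opp, h.next_five] at this
    exact ⟨c, hc, by rw [← this, M.opp_opp]⟩
  have ho : ∀ b, lab b = β →
      lab (M.next (M.next (M.opp (M.next (M.next (M.next b)))))) = β := by
    intro b hb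
    obtain ⟨c, hc, hbc⟩ := h3 b hb
    rw [hbc, h.next_five, hc]
  have hoo : ∀ b, M.next (M.next (M.opp (M.next (M.next (M.next
      (M.next (M.next (M.opp (M.next (M.next (M.next b))))))))))) = b := fun b => by
    rw [h.next_five, M.opp_opp, h.next_five]
  -- `next` is `vert⁻¹`, because the subdivision rotates its corners `ε` by `next⁻¹`; `opp` crosses
  -- edge 3.
  let N : OMap {d // lab d = β} :=
    { next :=
        { toFun := fun b => ⟨M.opp (M.next (M.next (M.next (M.next b.1)))), h.lab_opp_four b.2⟩
          invFun := fun b => ⟨M.next (M.opp b.1), (h.lab_vert b).trans b.2⟩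
          left_inv := fun b => Subtype.ext (h.next_opp_opp_four b.1)
          right_inv := fun b => Subtype.ext (by simp [h.next_five, M.opp_opp]) }
      opp := Function.Involutive.toPerm
        (fun b => ⟨M.next (M.next (M.opp (M.next (M.next (M.next b.1))))), ho b.1 b.2⟩)
        fun b => Subtype.ext (hoo b.1)
      opp_opp := fun b => Subtype.ext (hoo b.1)
      opp_ne := fun b hb => by
        have h0 : M.next (M.next (M.opp (M.next (M.next (M.next b.1))))) = b.1 :=
          congrArg Subtype.val hb
        have := congrArg (fun d => M.next (M.next (M.next d))) h0
        simp only [h.next_five] at this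
        exact M.opp_ne _ this }
  let f : {d // lab d = β} × Corner → D
    | (b, .ε) => b
    | (b, .α) => M.next b
    | (b, .δ) => M.next (M.next b)
    | (b, .β) => M.next (M.next (M.next b))
    | (b, .γ) => M.next (M.next (M.next (M.next b)))
  have hfn : ∀ x, f ((pentSub N).next x) = M.next (f x) := by
    rintro ⟨b, c⟩
    cases c
    exacts [rfl, rfl, (h.next_five b).symm, rfl, rfl]
  have hfα : ∀ b, f ((pentSub N).opp (b, .α)) = M.opp (f (b, .α)) := by
    intro b
    obtain ⟨c, hc, hbc⟩ := ht b.1 b.2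
    have h3 := h.opp_three_of_twisted b.2 hbc
    change M.next (M.next (M.next (M.next (M.opp (M.next (M.next (M.next
      (M.next (M.opp b.1))))))))) = M.opp (M.next b.1)
    rw [hbc, ← h3, M.opp_opp, h.next_five]
  have hfo : ∀ x, f ((pentSub N).opp x) = M.opp (f x) := by
    rintro ⟨b, c⟩
    cases c
    · exact hfα b
    · exact h.next_five _
    · rfl
    -- Edge `δ` is the other side of an edge `α`.
    · have := hfα (N.next (N.opp b))
      have h1 : (pentSub N).opp (N.next (N.opp b), .α) = (b, .δ) := by
        simp [pentSub, pentSubOpp, N.opp_opp]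
      have h2 : (pentSub N).opp (b, .δ) = (N.next (N.opp b), .α) := rfl
      rw [h1] at this
      rw [h2, this, M.opp_opp]
    · exact (h.opp_zero _).symm
  have hfl : ∀ x, lab (f x) = β ↔ x.2 = .ε := by
    rintro ⟨⟨b, hb⟩, c⟩
    cases c <;> simp [f, hb, h.lab_one b hb, h.lab_two b hb, h.lab_three hb, h.lab_four hb]
  have hinj : Function.Injective f := by
    have key : ∀ x y, x.2 = .ε → f x = f y → x = y := by
      rintro ⟨b, c⟩ ⟨b', c'⟩ rfl hxy
      have : c' = .ε := (hfl (b', c')).1 (hxy ▸ (hfl (b, .ε)).2 rfl)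
      subst this
      rw [Prod.mk.injEq]
      exact ⟨Subtype.ext hxy, rfl⟩
    have hpow : ∀ i x, f (((pentSub N).next ^ i) x) = (M.next ^ i) (f x) := by
      intro i x
      induction i with
      | zero => rfl
      | succ i ih => rw [pow_succ', pow_succ', Equiv.Perm.mul_apply, hfn, ih]; rfl
    intro x y hxy
    obtain ⟨i, hi⟩ : ∃ i : ℕ, (Corner.rot ^ i) x.2 = .ε := by
      have : ∀ c, ∃ i < 5, (Corner.rot ^ i) c = .ε := by decide
      obtain ⟨i, -, hi⟩ := this x.2
      exact ⟨i, hi⟩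
    apply ((pentSub N).next ^ i).injective
    apply key
    · rw [← Prod.mk.eta (p := x), pentSub_next_pow, hi]
    · rw [hpow, hpow, hxy]
  have hsurj : Function.Surjective f := by
    intro d
    obtain ⟨b, hb, hd⟩ := h.exists_tile d
    rcases hd with rfl | rfl | rfl | rfl | rfl
    exacts [⟨(⟨_, hb⟩, .ε), rfl⟩, ⟨(⟨_, hb⟩, .α), rfl⟩, ⟨(⟨_, hb⟩, .δ), rfl⟩,
      ⟨(⟨_, hb⟩, .β), rfl⟩, ⟨(⟨_, hb⟩, .γ), rfl⟩]
  have hfv : ∀ i x, f (((pentSub N).vert ^ i) x) = (M.vert ^ i) (f x) := by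
    intro i x
    induction i with
    | zero => rfl
    | succ i ih =>
      rw [pow_succ', pow_succ', Equiv.Perm.mul_apply, Equiv.Perm.mul_apply, ← ih]
      exact (hfn _).trans (congrArg _ (hfo _))
  refine ⟨N, Equiv.ofBijective f ⟨hinj, hsurj⟩, hfn, hfo, hfl, fun d => ?_, fun d => ?_, ?_⟩
  · have hp : ∀ i : ℕ, ((pentSub N).vert ^ i) (d, .ε) = ((N.next⁻¹ ^ i) d, .ε) := fun i => by
      induction i with
      | zero => rfl
      | succ i ih => rw [pow_succ', Equiv.Perm.mul_apply, ih, pow_succ']; rfl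
    have := hfv k (d, .ε)
    rw [h.vert_pow _ ((hfl (d, .ε)).2 rfl), hp] at this
    have := congrArg Prod.fst (hinj (a₁ := ((N.next⁻¹ ^ k) d, .ε)) (a₂ := (d, .ε)) this)
    rw [inv_pow, Equiv.Perm.inv_eq_iff_eq] at this
    exact this.symm
  · have hp : ∀ i : ℕ, ((pentSub N).vert ^ i) (d, .δ) = ((N.vert ^ i) d, .δ) := fun i => by
      induction i with
      | zero => rfl
      | succ i ih => rw [pow_succ', Equiv.Perm.mul_apply, ih, pow_succ']; rfl
    have := hfv 3 (d, .δ)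
    have h3 : (M.vert ^ 3) (f (d, .δ)) = f (d, .δ) :=
      h.vert_three _ fun hl => by simpa using (hfl (d, .δ)).1 hl
    rw [h3, hp] at this
    exact congrArg Prod.fst (hinj (a₁ := ((N.vert ^ 3) d, .δ)) (a₂ := (d, .δ)) this)
  · refine OMap.Connected.of_pentSub fun a b => ?_
    refine OMap.connected_of_forall_closed a (fun S ha hn ho x => ?_) a b
    have := h.connected.mem_of_closed (S := f '' S) ⟨a, ha, rfl⟩ ?_ ?_ (f x)
    · rwa [hinj.mem_set_image] at this
    · rintro _ ⟨x, hx, rfl⟩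
      exact ⟨_, hn _ hx, hfn x⟩
    · rintro _ ⟨x, hx, rfl⟩
      exact ⟨_, ho _ hx, hfo x⟩

section

variable {D L : Type*} [Fintype D] {M : OMap D} {lab : D → L} {α β : L} {n a b k : ℕ}

theorem IsTilingFor.localTiling (hαβ : α ≠ β)
    (h : IsTilingFor M lab ⟨Multiset.replicate n {α, α, α, α, β},
      Multiset.replicate a (Multiset.replicate 3 α) +
        Multiset.replicate b (Multiset.replicate k β)⟩) : LocalTiling M lab β k := by
  classical
  have h5 := h.pentagonal.next_pow_five
  have hper : ∀ d, Function.minimalPeriod M.next d = 5 := fun d => by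
    rw [← natCard_sameCycle, h.pentagonal.1]
  have htile : ∀ d, ({lab d, lab (M.next d), lab (M.next (M.next d)),
      lab (M.next (M.next (M.next d))), lab (M.next (M.next (M.next (M.next d))))} : Multiset L) =
      {α, α, α, α, β} := fun d => by
    have h1 := orbitLabels_mem_combinations M.next lab d
    rw [h.tiles] at h1
    have h2 := Multiset.eq_of_mem_replicate h1
    rw [orbitLabels_mk, hper] at h2
    rw [← h2]
    rfl
  have hvert : ∀ d, Function.minimalPeriod M.vert d = 3 ∧
      (∀ i, i < 3 → lab ((M.vert ^ i) d) = α) ∨ Function.minimalPeriod M.vert d = k ∧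
      (∀ i, i < k → lab ((M.vert ^ i) d) = β) := fun d => by
    have h1 := orbitLabels_mem_combinations M.vert lab d
    rw [h.vertices, Multiset.mem_add] at h1
    refine h1.imp (fun h1 => ?_) fun h1 => ?_
    all_goals
      have h2 := Multiset.eq_of_mem_replicate h1
      have h3 := congrArg Multiset.card h2
      rw [card_orbitLabels_mk, Multiset.card_replicate] at h3
      refine ⟨h3, fun i hi => ?_⟩
      rw [orbitLabels_mk, Multiset.eq_replicate] at h2
      exact h2.2 _ (Multiset.mem_map_of_mem _ (Multiset.mem_range.2 (h3 ▸ hi)))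
  have hpos : ∀ d, 0 < Function.minimalPeriod M.vert d := fun d =>
    Function.minimalPeriod_pos_of_mem_periodicPts
      (Function.Injective.mem_periodicPts M.vert.injective d)
  have hα : ∀ b, lab b = β → lab (M.next b) ≠ β ∧ lab (M.next (M.next b)) ≠ β := fun b hb => by
    have h1 := congrArg (Multiset.count β) (htile b)
    simp only [Multiset.insert_eq_cons, Multiset.count_cons, Multiset.count_singleton, hb, if_true,
      hαβ.symm, if_false] at h1
    constructor <;> intro h2 <;> rw [h2] at h1 <;> simp at h1
  refine ⟨h.sphere.1, fun d => ?_, fun d => ?_, fun b hb => (hα b hb).1, fun b hb => (hα b hb).2,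
    fun d => ?_, fun d hd => ?_, fun d hd => ?_⟩
  · exact congrArg (fun p : Equiv.Perm D => p d) h5
  · have hfive : ∀ d, M.next (M.next (M.next (M.next (M.next d)))) = d :=
      fun d => congrArg (fun p : Equiv.Perm D => p d) h5
    have : β ∈ ({α, α, α, α, β} : Multiset L) := by simp
    rw [← htile d] at this
    simp only [Multiset.insert_eq_cons, Multiset.mem_cons, Multiset.mem_singleton] at this
    rcases this with h | h | h | h | h <;> refine ⟨_, h.symm, ?_⟩ <;> simp only [hfive] <;> tauto
  · change lab (M.vert d) = lab d
    rcases hvert d with ⟨-, h2⟩ | ⟨h1, h2⟩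
    · exact (h2 1 (by norm_num)).trans (h2 0 (by norm_num)).symm
    · have hd : lab d = β := h2 0 (h1 ▸ hpos d)
      -- `k` could be 1 here, so `h2` gives nothing at index 1. If `vert d` were at an `α`-vertex,
      -- two more rotations would return to `d` and label it `α`.
      rcases hvert (M.vert d) with ⟨h3, h4⟩ | ⟨h3, h4⟩
      · have := pow_eq_self_of_minimalPeriod_eq h3
        rw [pow_succ', Equiv.Perm.mul_apply] at this
        have h5 := h4 2 (by norm_num)
        rw [M.vert.injective this, hd] at h5
        exact absurd h5.symm hαβ
      · exact (h4 0 (h3 ▸ hpos _)).trans hd.symm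
  · rcases hvert d with ⟨h1, -⟩ | ⟨h1, h2⟩
    · exact pow_eq_self_of_minimalPeriod_eq h1
    · exact absurd (h2 0 (h1 ▸ hpos d)) hd
  · rcases hvert d with ⟨-, h2⟩ | ⟨h1, -⟩
    · exact absurd ((h2 0 (by norm_num)).symm.trans hd) hαβ
    · exact pow_eq_self_of_minimalPeriod_eq h1

end

end SphereTiling

/-! ### Assembly -/

namespace SphereTiling

variable {D L : Type*} [Fintype D] {M : OMap D} {lab : D → L} {α β : L} {n a b k : ℕ}

/-- A tiling with `n` tiles and `AVC = {α⁴β : α³, βᵏ}` is the pentagonal subdivision of `P`, if `P`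
is the only map with `n` oriented edges, tiles with `k` edges, and vertices of degree three. -/
theorem IsTilingFor.sameTiling_pentSub {F : Type*} {P : OMap F} (hαβ : α ≠ β)
    (h : IsTilingFor M lab ⟨Multiset.replicate n {α, α, α, α, β},
      Multiset.replicate a (Multiset.replicate 3 α) +
        Multiset.replicate b (Multiset.replicate k β)⟩)
    (hP : ∀ (N : OMap {d // lab d = β}), Nat.card {d // lab d = β} = n → N.Connected →
      (∀ d, (N.next ^ k) d = d) → (∀ d, (N.vert ^ 3) d = d) →
      ∃ e : F ≃ {d // lab d = β}, (∀ d, e (P.next d) = N.next (e d)) ∧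
        ∀ d, e (P.opp d) = N.opp (e d)) :
    SameTiling M lab (pentSub P) fun c => reduce2D α β c.2 := by
  classical
  have hL := h.localTiling hαβ
  have hlab : ∀ d, lab d = α ∨ lab d = β := fun d => by
    have h1 := orbitLabels_mem_combinations M.next lab d
    rw [h.tiles] at h1
    have h2 : lab d ∈ orbitLabels M.next lab (Quotient.mk _ d) := by
      rw [orbitLabels]
      exact Multiset.mem_map_of_mem _ (by simp)
    rw [Multiset.eq_of_mem_replicate h1] at h2
    simp at h2
    exact h2
  have hcard : Nat.card {d // lab d = β} = n := by
    have h1 := sum_combinations M.next lab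
    rw [h.tiles, Multiset.sum_replicate] at h1
    have h2 := congrArg (Multiset.count β) h1
    rw [Multiset.count_nsmul, Multiset.count_map] at h2
    simp only [Multiset.insert_eq_cons, Multiset.count_cons, Multiset.count_singleton, if_true,
      hαβ.symm, if_false] at h2
    rw [Nat.card_eq_fintype_card, Fintype.card_subtype, Finset.card_def, Finset.filter_val]
    simp only [eq_comm (a := β)] at h2
    rw [← h2]
    simp
  have key : ∀ M : OMap D, LocalTiling M lab β k →
      (∀ b, lab b = β → LocalTiling.Twisted M lab β b) →
      SameTiling M lab (pentSub P) fun c => reduce2D α β c.2 := by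
    intro M hL ht
    obtain ⟨N, e, hn, ho, hl, hNn, hNv, hN⟩ := exists_pentSub_equiv_of_twisted hL ht
    obtain ⟨f, hfn, hfo⟩ := hP N hcard hN hNn hNv
    let g : F × Corner ≃ D := (f.prodCongr (Equiv.refl Corner)).trans e
    have hgn : ∀ x, g ((pentSub P).next x) = M.next (g x) := fun x =>
      hn (f x.1, x.2)
    have hgo : ∀ x, g ((pentSub P).opp x) = M.opp (g x) := fun x =>
      (congrArg e (pentSub_congr hfn hfo x)).trans (ho (f x.1, x.2))
    have hgl : ∀ x, lab (g x) = reduce2D α β x.2 := fun x => by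
      have h1 : lab (g x) = β ↔ x.2 = .ε := hl (f x.1, x.2)
      obtain ⟨d, c⟩ := x
      by_cases hc : c = .ε
      · subst hc
        exact h1.2 rfl
      · have h2 : reduce2D α β c = α := by cases c <;> simp_all [reduce2D]
        exact ((hlab _).resolve_right fun h => hc (h1.1 h)).trans h2.symm
    refine sameTiling_iff.2 ⟨g.symm, fun d => ?_, Or.inl ⟨fun d => ?_, fun d => ?_⟩⟩
    · rw [← hgl, Equiv.apply_symm_apply]
    · rw [Equiv.symm_apply_eq, hgn, Equiv.apply_symm_apply]
    · rw [Equiv.symm_apply_eq, hgo, Equiv.apply_symm_apply]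
  rcases hL.forall_twisted_or_mirror with ht | ht
  · exact key M hL ht
  · exact (key M.mirror hL.mirror ht).of_mirror

end SphereTiling

theorem theorem3 {L : Type*} (α β : L) (hαβ : α ≠ β) {D : Type*} [Fintype D]
    (M : SphereTiling.OMap D) (lab : D → L) :
    (SphereTiling.IsTilingFor M lab (SphereTiling.avc2D24 α β) ↔
      SphereTiling.SameTiling M lab SphereTiling.PP6
        (fun c => SphereTiling.reduce2D α β c.2)) ∧
    (SphereTiling.IsTilingFor M lab (SphereTiling.avc2D60 α β) ↔
      SphereTiling.SameTiling M lab SphereTiling.PP12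
        (fun c => SphereTiling.reduce2D α β c.2)) := by
  classical
  refine ⟨⟨fun h => ?_, (SphereTiling.isTilingFor_PP6 hαβ).of_sameTiling⟩,
    ⟨fun h => ?_, (SphereTiling.isTilingFor_PP12 hαβ).of_sameTiling⟩⟩
  -- The explicit multisets of `avc2D24` unfold to the `replicate` form with these parameters.
  · refine SphereTiling.IsTilingFor.sameTiling_pentSub (n := 24) (a := 32) (b := 6) (k := 4)
      hαβ h fun N hcard hN hn hv => ?_
    rw [Nat.card_eq_fintype_card] at hcard
    exact SphereTiling.exists_equiv_cube hcard hN hn hv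
  · refine SphereTiling.IsTilingFor.sameTiling_pentSub (n := 60) (a := 80) (b := 12) (k := 5)
      hαβ h fun N hcard hN hn hv => ?_
    rw [Nat.card_eq_fintype_card] at hcard
    exact SphereTiling.exists_equiv_dodecahedron hcard hN hn hv
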